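/- **Definitions.** An instance $\mathcal I=(\tilde G=(V_1,V_2,E),\mathcal U_1,\mathcal U_2,h,r)$ of $(r,h)$-Graph Partitioning with Bundles consists of a finite bipartite graph with sides $V_1,V_2$ and edge set $E$, integers $h,r>0$, and partitions $\mathcal U_1$ of $V_1$ and $\mathcal U_2$ of $V_2$ into groups of exactly $r$ vertices. For $v\in V_1$ and $U\in\mathcal U_2$ (or $v\in V_2$ and $U\in\mathcal U_1$), the set of edges between $v$ and $U$, if non-empty, is a *bundle* of $v$; $\beta(v)$ is the number of bundles of $v$, and $\beta^*=\sum_{v\in V_1}\beta(v)$. The instance is *valid* if $h=\beta^*/r$ and $h\ge\beta(v)$ for all $v\in V_1\cup V_2$. A *solution* is a partition $(W_1,\dots,W_r)$ of $V_1\cup V_2$ together with sets $E_i$ of at most $h$ edges inside $W_i$ such that each $E_i$ contains at most one edge of each bundle; it is *perfect* if every $W_i$ contains exactly one vertex of each group and $|E_i|=h$ for all $i$. Let $M=|E|\ge 2$, $N_1=|V_1|$, $N_2=|V_2|$, let $\log$ be the binary logarithm, and $\ell=2048\lceil M^2\log M\rceil$. Given an ordering $\rho$ of $\mathcal U_1$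 and an ordering $\rho'$ of $\mathcal U_2$, an instance of the node-disjoint paths problem on the $(\ell\times\ell)$-grid is constructed as follows. Order $V_1=\{v_1,\dots,v_{N_1}\}$ and $V_2=\{v'_1,\dots,v'_{N_2}\}$ so that the groups appear in the order $\rho$, respectively $\rho'$ (with an arbitrary order inside each group). Choose rows $R',R''$ of the grid at distance at least $\ell/4$ from each other and from the top and bottom rows. On $R'$ choose disjoint sub-paths $K_1,\dots,K_{N_1}$ from left to right, each with $1024\lceil h\log M\rceil$ vertices, separated by at least $10M$ vertices from each other and from the leftmost and rightmost columns; choose $K'_1,\dots,K'_{N_2}$ on $R''$ in the same way. For each bundle $B$ of $v_i$ place a source $s_B$ on $K_i$, in the order that $\rho'$ induces on the groups of $V_2$ corresponding to the bundles, so that exactly $512\lceil h\log M/\beta(v_i)\rceil$ vertices lie between consecutive sources. For each bundle $B'$ of $v'_i$ place a destination $t_{B'}$ on $K'_i$, in the order induced by $\rho$, so that exactly $512\lceil h\log M/\beta(v'_i)\rceil$ vertices lie between consecutive destinations. Every edge $e\in E$ gives the demand pair $(s_B,t_{B'})$, where $B$ and $B'$ are the bundles of its endpoints in $V_1$ and $V_2$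 that contain $e$. A set of paths in the grid is *spaced-out* if any two distinct paths of the set are at grid distance at least $2$ and no inner vertex of any of the paths lies on the boundary of the grid. **Theorem.** There is a universal constant $c>0$ such that the following holds for every valid instance $\mathcal I$ with $M\ge 2$ that has a perfect solution. 1. If $N_1,N_2\le M$, then for all orderings $\rho,\rho'$ of $\mathcal U_1,\mathcal U_2$ the choices required by the construction can be made. 2. For every ordering $\rho$ of $\mathcal U_1$, with probability at least $1/2$ over a uniformly random ordering $\rho'$ of $\mathcal U_2$, the constructed instance has, however the remaining choices are made, a spaced-out set of paths routing at least $c\,\beta^*/\log^3 M$ demand pairs. -/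

import Mathlib

/-- An instance of the `(r,h)`-graph partitioning problem with bundles: a finite bipartite graph
with sides `V₁`, `V₂` and edge set `edges`, partitions of `V₁` and of `V₂` into groups of exactly
`r` vertices each, and two positive integers `r`, `h`. -/
structure GPwB (V₁ V₂ : Type*) [Fintype V₁] [DecidableEq V₁] [Fintype V₂] [DecidableEq V₂] where
  edges : Finset (V₁ × V₂)
  groups₁ : Finpartition (Finset.univ : Finset V₁)
  groups₂ : Finpartition (Finset.univ : Finset V₂)
  h : ℕ
  r : ℕ
  h_pos : 0 < h
  r_pos : 0 < r
  card_groups₁ : ∀ U ∈ groups₁.parts, U.card = r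
  card_groups₂ : ∀ U ∈ groups₂.parts, U.card = r

/-- An ordering of the groups of a partition: each group receives its position. -/
abbrev GroupOrder {V : Type*} [Fintype V] [DecidableEq V]
    (P : Finpartition (Finset.univ : Finset V)) : Type _ :=
  {U : Finset V // U ∈ P.parts} ≃ Fin P.parts.card

instance {V : Type*} [Fintype V] [DecidableEq V]
    (P : Finpartition (Finset.univ : Finset V)) : Nonempty (GroupOrder P) :=
  ⟨P.parts.equivFin⟩

/-- The group of a partition that contains a given vertex. -/
def groupOf {V : Type*} [Fintype V] [DecidableEq V]
    (P : Finpartition (Finset.univ : Finset V)) (v : V) : {U : Finset V // U ∈ P.parts} :=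
  ⟨P.part v, P.part_mem.2 (Finset.mem_univ v)⟩

namespace GPwB

variable {V₁ V₂ : Type*} [Fintype V₁] [DecidableEq V₁] [Fintype V₂] [DecidableEq V₂]

/-- `M`, the number of edges. -/
def M (I : GPwB V₁ V₂) : ℕ := I.edges.card

/-- The edges that connect `v ∈ V₁` to the vertices of `U ⊆ V₂`; a bundle if non-empty. -/
def bundle₁ (I : GPwB V₁ V₂) (v : V₁) (U : Finset V₂) : Finset (V₁ × V₂) :=
  I.edges.filter fun e => e.1 = v ∧ e.2 ∈ U

/-- The edges that connect `v ∈ V₂` to the vertices of `U ⊆ V₁`; a bundle if non-empty. -/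
def bundle₂ (I : GPwB V₁ V₂) (v : V₂) (U : Finset V₁) : Finset (V₁ × V₂) :=
  I.edges.filter fun e => e.2 = v ∧ e.1 ∈ U

/-- The groups of `V₂` that have an edge to `v ∈ V₁`, that is, the groups `U(B)` of the bundles `B`
of `v`. -/
def bundleGroups₁ (I : GPwB V₁ V₂) (v : V₁) : Finset {U : Finset V₂ // U ∈ I.groups₂.parts} :=
  Finset.univ.filter fun U => (I.bundle₁ v U.1).Nonempty

/-- The groups of `V₁` that have an edge to `v ∈ V₂`. -/
def bundleGroups₂ (I : GPwB V₁ V₂) (v : V₂) : Finset {U : Finset V₁ // U ∈ I.groups₁.parts} :=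
  Finset.univ.filter fun U => (I.bundle₂ v U.1).Nonempty

/-- The set of all bundles of a vertex `v ∈ V₁`. -/
def bundles₁ (I : GPwB V₁ V₂) (v : V₁) : Finset (Finset (V₁ × V₂)) :=
  (I.bundleGroups₁ v).image fun U => I.bundle₁ v U.1

/-- The set of all bundles of a vertex `v ∈ V₂`. -/
def bundles₂ (I : GPwB V₁ V₂) (v : V₂) : Finset (Finset (V₁ × V₂)) :=
  (I.bundleGroups₂ v).image fun U => I.bundle₂ v U.1

/-- `β(v)` for `v ∈ V₁`, the number of bundles of `v`. -/
def beta₁ (I : GPwB V₁ V₂) (v : V₁) : ℕ := (I.bundles₁ v).card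

/-- `β(v)` for `v ∈ V₂`, the number of bundles of `v`. -/
def beta₂ (I : GPwB V₁ V₂) (v : V₂) : ℕ := (I.bundles₂ v).card

/-- `β* = ∑_{v ∈ V₁} β(v)`. -/
def betaStar (I : GPwB V₁ V₂) : ℕ := ∑ v : V₁, I.beta₁ v

/-- The instance is valid: `h = β* / r` (an equation of rational numbers) and `h ≥ max_v β(v)`. -/
def Valid (I : GPwB V₁ V₂) : Prop :=
  (I.h : ℚ) = (I.betaStar : ℚ) / (I.r : ℚ) ∧
    (∀ v, I.beta₁ v ≤ I.h) ∧ (∀ v, I.beta₂ v ≤ I.h)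

/-- A solution: a partition of `V₁ ∪ V₂` into clusters `W_1, …, W_r`, given by the cluster number of
each vertex, and for each `i` a set `E_i` of at most `h` edges inside `W_i` that has at most one
edge in each bundle. -/
structure Solution (I : GPwB V₁ V₂) where
  W : V₁ ⊕ V₂ → Fin I.r
  E : Fin I.r → Finset (V₁ × V₂)
  E_sub : ∀ i, E i ⊆ I.edges
  E_inside : ∀ i, ∀ e ∈ E i, W (Sum.inl e.1) = i ∧ W (Sum.inr e.2) = i
  E_card : ∀ i, (E i).card ≤ I.h
  E_bundle₁ : ∀ i v, ∀ B ∈ I.bundles₁ v, (E i ∩ B).card ≤ 1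
  E_bundle₂ : ∀ i v, ∀ B ∈ I.bundles₂ v, (E i ∩ B).card ≤ 1

/-- A solution is perfect if each cluster contains exactly one vertex of each group, and each `E_i`
has exactly `h` edges. -/
def Solution.Perfect {I : GPwB V₁ V₂} (S : I.Solution) : Prop :=
  (∀ U ∈ I.groups₁.parts, ∀ i, ∃! v, v ∈ U ∧ S.W (Sum.inl v) = i) ∧
    (∀ U ∈ I.groups₂.parts, ∀ i, ∃! v, v ∈ U ∧ S.W (Sum.inr v) = i) ∧
    ∀ i, (S.E i).card = I.h

/-- The side length `ℓ = 2048 ⌈M² log M⌉` of the grid (binary logarithm). -/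
noncomputable def side (I : GPwB V₁ V₂) : ℕ :=
  2048 * ⌈(I.M : ℝ) ^ 2 * Real.logb 2 I.M⌉₊

/-- The number `1024 ⌈h log M⌉` of vertices of a block. -/
noncomputable def blockLen (I : GPwB V₁ V₂) : ℕ :=
  1024 * ⌈(I.h : ℝ) * Real.logb 2 I.M⌉₊

/-- The number `512 ⌈h log M / β⌉` of vertices that separate consecutive terminals in the block of a
vertex with `β` bundles. -/
noncomputable def gap (I : GPwB V₁ V₂) (β : ℕ) : ℕ :=
  512 * ⌈(I.h : ℝ) * Real.logb 2 I.M / (β : ℝ)⌉₊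

end GPwB

/-- An ordering `σ` of the vertices agrees with an ordering `ρ` of the groups: vertices of an
earlier group come first (so that each group is consecutive, in an arbitrary inner order). -/
def RespectsGroups {V : Type*} [Fintype V] [DecidableEq V]
    {P : Finpartition (Finset.univ : Finset V)} (ρ : GroupOrder P) (σ : V ≃ Fin (Fintype.card V)) :
    Prop :=
  ∀ u v, ρ (groupOf P u) < ρ (groupOf P v) → σ u < σ v

/-- `U` comes immediately before `U'` among the groups in `A`, with respect to the order `ρ`. -/
def ConsecutiveIn {V : Type*} [Fintype V] [DecidableEq V]
    {P : Finpartition (Finset.univ : Finset V)} (ρ : GroupOrder P)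
    (A : Finset {U : Finset V // U ∈ P.parts}) (U U' : {U : Finset V // U ∈ P.parts}) : Prop :=
  U ∈ A ∧ U' ∈ A ∧ ρ U < ρ U' ∧ ∀ U'' ∈ A, ¬ (ρ U < ρ U'' ∧ ρ U'' < ρ U')

/-- Row number `i` (counted from `0`) of the `(ℓ × ℓ)`-grid is at distance at least `ℓ/4` from the
top and from the bottom row. -/
def RowFarFromBoundary (ℓ i : ℕ) : Prop :=
  (ℓ : ℝ) / 4 ≤ (i : ℝ) ∧ (ℓ : ℝ) / 4 ≤ (ℓ : ℝ) - 1 - (i : ℝ)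

/-- `n` blocks of `len` vertices on a row of the `(ℓ × ℓ)`-grid, the `i`-th one starting in column
`start i` (counted from `0`), appear from left to right, and at least `d` vertices lie between two
of them, and between each of them and the leftmost and the rightmost column. -/
def BlocksSeparated (ℓ len d : ℕ) {n : ℕ} (start : Fin n → ℕ) : Prop :=
  (∀ i j, i < j → start i + len + d ≤ start j) ∧
    (∀ i, 1 + d ≤ start i) ∧ ∀ i, start i + len + d + 1 ≤ ℓ

/-- The placement of the terminals in the `(ℓ × ℓ)`-grid, `ℓ = I.side`, for an ordering `ρ` of the
groups of `V₁` and an ordering `ρ'` of the groups of `V₂`. It collects all choices that the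
construction leaves arbitrary. Rows and columns are numbered from `0`. -/
structure Layout {V₁ V₂ : Type*} [Fintype V₁] [DecidableEq V₁] [Fintype V₂] [DecidableEq V₂]
    (I : GPwB V₁ V₂) (ρ : GroupOrder I.groups₁) (ρ' : GroupOrder I.groups₂) where
  /-- the orderings of the vertices of `V₁` and `V₂` -/
  σ : V₁ ≃ Fin (Fintype.card V₁)
  σ' : V₂ ≃ Fin (Fintype.card V₂)
  σ_respects : RespectsGroups ρ σ
  σ'_respects : RespectsGroups ρ' σ'
  /-- the row `R'` of the sources and the row `R''` of the destinations -/
  rowS : Fin I.side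
  rowT : Fin I.side
  rowS_far : RowFarFromBoundary I.side rowS
  rowT_far : RowFarFromBoundary I.side rowT
  rows_far : (I.side : ℝ) / 4 ≤ |((rowS : ℕ) : ℝ) - ((rowT : ℕ) : ℝ)|
  /-- the first columns of the blocks of the vertices of `V₁`, and of `V₂`, in their order -/
  start : Fin (Fintype.card V₁) → ℕ
  start' : Fin (Fintype.card V₂) → ℕ
  start_sep : BlocksSeparated I.side I.blockLen (10 * I.M) start
  start'_sep : BlocksSeparated I.side I.blockLen (10 * I.M) start'
  /-- `colS v U` is the column of the source `s_B` of the bundle `B` between `v` and `U`, and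
  `colT v U` that of the destination `t_B`. Values where there is no bundle are irrelevant. -/
  colS : V₁ → {U : Finset V₂ // U ∈ I.groups₂.parts} → Fin I.side
  colT : V₂ → {U : Finset V₁ // U ∈ I.groups₁.parts} → Fin I.side
  colS_block : ∀ v, ∀ U ∈ I.bundleGroups₁ v,
    start (σ v) ≤ (colS v U : ℕ) ∧ (colS v U : ℕ) < start (σ v) + I.blockLen
  colT_block : ∀ v, ∀ U ∈ I.bundleGroups₂ v,
    start' (σ' v) ≤ (colT v U : ℕ) ∧ (colT v U : ℕ) < start' (σ' v) + I.blockLen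
  /-- the terminals of a block appear in the order of the groups of their bundles, and exactly
  `gap` vertices lie between two consecutive ones -/
  colS_gap : ∀ v U U', ConsecutiveIn ρ' (I.bundleGroups₁ v) U U' →
    (colS v U' : ℕ) = (colS v U : ℕ) + I.gap (I.beta₁ v) + 1
  colT_gap : ∀ v U U', ConsecutiveIn ρ (I.bundleGroups₂ v) U U' →
    (colT v U' : ℕ) = (colT v U : ℕ) + I.gap (I.beta₂ v) + 1

/-- The vertices of the `(ℓ × ℓ)`-grid, as pairs (row, column). -/
abbrev GridVertex (ℓ : ℕ) : Type := Fin ℓ × Fin ℓ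

/-- The `(ℓ × ℓ)`-grid. -/
abbrev grid (ℓ : ℕ) : SimpleGraph (GridVertex ℓ) :=
  SimpleGraph.boxProd (SimpleGraph.pathGraph ℓ) (SimpleGraph.pathGraph ℓ)

/-- The vertex lies in the first or last row or in the first or last column. -/
def OnBoundary {ℓ : ℕ} (x : GridVertex ℓ) : Prop :=
  (x.1 : ℕ) = 0 ∨ (x.1 : ℕ) + 1 = ℓ ∨ (x.2 : ℕ) = 0 ∨ (x.2 : ℕ) + 1 = ℓ

/-- The demand pairs of the constructed instance: one pair `(s_B, t_B')` for each edge, where `B`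
and `B'` are the two bundles that contain the edge. -/
noncomputable def Layout.demandPairs {V₁ V₂ : Type*} [Fintype V₁] [DecidableEq V₁] [Fintype V₂] [DecidableEq V₂]
    {I : GPwB V₁ V₂} {ρ : GroupOrder I.groups₁} {ρ' : GroupOrder I.groups₂}
    (L : Layout I ρ ρ') : Finset (GridVertex I.side × GridVertex I.side) :=
  I.edges.image fun e =>
    ((L.rowS, L.colS e.1 (groupOf I.groups₂ e.2)), (L.rowT, L.colT e.2 (groupOf I.groups₁ e.1)))

/-- The family of paths, one for each demand pair in `D`, is spaced-out: any two of its paths are at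
distance at least `2` in the grid (in particular they are node-disjoint), and all of them are
internally disjoint from the boundary of the grid. -/
def SpacedOut {ℓ : ℕ} {D : Finset (GridVertex ℓ × GridVertex ℓ)}
    (P : ∀ d : D, (grid ℓ).Path d.1.1 d.1.2) : Prop :=
  (∀ d d' : D, d ≠ d' → ∀ x ∈ (P d).1.support, ∀ y ∈ (P d').1.support, 2 ≤ (grid ℓ).dist x y) ∧
    ∀ d : D, ∀ x ∈ (P d).1.support, OnBoundary x → x = d.1.1 ∨ x = d.1.2

/-- In the `(ℓ × ℓ)`-grid with demand pairs `𝓜`, at least `k` demand pairs can be routed by a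
spaced-out set of paths. -/
def CanRouteSpacedOut {ℓ : ℕ} (𝓜 : Finset (GridVertex ℓ × GridVertex ℓ)) (k : ℝ) : Prop :=
  ∃ D : Finset (GridVertex ℓ × GridVertex ℓ), D ⊆ 𝓜 ∧ k ≤ (D.card : ℝ) ∧
    ∃ P : ∀ d : D, (grid ℓ).Path d.1.1 d.1.2, SpacedOut P

/-! A perfect solution contains `r * h = β*` edges. They are numbered lexicographically by cluster,
then by group in `V₂`, then by group in `V₁`; let `λ(e)` be the number of solution edges before `e`.
At least half of these edges can be routed simultaneously, whatever `ρ'` is. So the event has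
probability `1`, and `c = 1/2` suffices because `log M ≥ 1`.

Geometry (`exists_spacedOut_paths`): the line with number `λ` follows a curve near the source row to
the right, turns into column `ℓ - 2 - 4λ`, and returns along a curve near the destination row. Lines
with larger numbers are nested inside, and neighbouring curves are vertical translates by `4`. The
terminals need not be sorted by number: the common shape of the curves is a 1-Lipschitz function
equal to `4λ` at the column of each terminal, so every line meets its row exactly at its own
terminal. Such a function exists as soon as `4|λ(e) - λ(e')|` is at most the distance of the
terminals on each row.

It remains to check this inequality. Terminals in different blocks are at least `10M` apart, while
`λ ≤ M`. Within a block of `V₂`, solution edges at one vertex are consecutive in the numbering, so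
`λ` grows by at most one per bundle (`Perfect.bundleRank_le_add_keyRank`), against gaps of at least
`512`. Within a block of `V₁`, `λ` is monotone and grows by at most `h` in total, because all edges
in between belong to one cluster. It may jump, but the gaps add up to about `512h`, so keeping the
bundles at which column minus `4λ` attains a running maximum loses at most half of them
(`exists_balanced_subset`). -/

/-! ### Lipschitz extension on the integers. -/

/-- An integer-valued function on finitely many integers that is `1`-Lipschitz and takes values in
`[0, B]` extends to all integers. -/
theorem exists_lipschitz_extension {ι : Type*} [Finite ι] (c v : ι → ℤ) (B : ℤ) (hB : 0 ≤ B)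
    (hv : ∀ i j, |v i - v j| ≤ |c i - c j|) (h0 : ∀ i, 0 ≤ v i) (h1 : ∀ i, v i ≤ B) :
    ∃ f : ℤ → ℤ, (∀ x y, |f x - f y| ≤ |x - y|) ∧ (∀ i, f (c i) = v i) ∧
      ∀ x, 0 ≤ f x ∧ f x ≤ B := by
  cases nonempty_fintype ι
  rcases isEmpty_or_nonempty ι with hι | hι
  · exact ⟨fun _ => 0, by simp, fun i => (hι.false i).elim, by simp [hB]⟩
  -- The McShane extension, the lower envelope of the cones over the given values; it is nonnegative
  -- and is cut off at `B` below.
  let g : ℤ → ℤ := fun x => Finset.univ.inf' Finset.univ_nonempty fun i => v i + |x - c i|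
  have hg_le : ∀ x i, g x ≤ v i + |x - c i| := fun x i =>
    Finset.inf'_le (fun i => v i + |x - c i|) (Finset.mem_univ i)
  have hg_ex : ∀ x, ∃ i, g x = v i + |x - c i| := fun x => by
    obtain ⟨i, -, hi⟩ := Finset.exists_mem_eq_inf' Finset.univ_nonempty
      fun i => v i + |x - c i|
    exact ⟨i, hi⟩
  have hg : ∀ x y, g x ≤ g y + |x - y| := fun x y => by
    obtain ⟨i, hi⟩ := hg_ex y
    have := hg_le x i
    have := abs_sub_le x y (c i)
    linarith
  refine ⟨fun x => min B (g x), fun x y => ?_, fun i => ?_, fun x => ⟨?_, min_le_left _ _⟩⟩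
  · have h2 := hg x y
    have h3 := hg y x
    rw [abs_sub_comm y x] at h3
    have : 0 ≤ |x - y| := abs_nonneg _
    rw [abs_le]
    dsimp only
    omega
  · obtain ⟨j, hj⟩ := hg_ex (c i)
    have h2 := hg_le (c i) i
    have h3 := (le_abs_self _).trans (hv i j)
    have h4 := h1 i
    simp only [sub_self, abs_zero, add_zero] at h2
    dsimp only
    omega
  · obtain ⟨j, hj⟩ := hg_ex x
    have := h0 j
    have := abs_nonneg (x - c j)
    dsimp only
    omega

/-! ### Walks in the grid inside prescribed regions. -/

/-- Two vertices of the grid are joined by a walk all of whose vertices satisfy `S`. -/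
def LinkedIn {ℓ : ℕ} (S : ℤ → ℤ → Prop) (p q : GridVertex ℓ) : Prop :=
  ∃ w : (grid ℓ).Walk p q, ∀ z ∈ w.support, S (z.1 : ℕ) (z.2 : ℕ)

namespace LinkedIn

variable {ℓ : ℕ} {S : ℤ → ℤ → Prop} {p q u : GridVertex ℓ}

theorem refl (h : S (p.1 : ℕ) (p.2 : ℕ)) : LinkedIn S p p := ⟨.nil, by simpa using h⟩

theorem symm (h : LinkedIn S p q) : LinkedIn S q p := by
  obtain ⟨w, hw⟩ := h
  exact ⟨w.reverse, by simpa using hw⟩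

theorem trans (h : LinkedIn S p q) (h' : LinkedIn S q u) : LinkedIn S p u := by
  obtain ⟨w, hw⟩ := h
  obtain ⟨w', hw'⟩ := h'
  refine ⟨w.append w', fun z hz => ?_⟩
  rcases (SimpleGraph.Walk.mem_support_append_iff _ _).1 hz with hz | hz
  exacts [hw z hz, hw' z hz]

theorem of_adj (h : (grid ℓ).Adj p q) (hp : S (p.1 : ℕ) (p.2 : ℕ)) (hq : S (q.1 : ℕ) (q.2 : ℕ)) :
    LinkedIn S p q := by
  refine ⟨h.toWalk, fun z hz => ?_⟩
  simp only [SimpleGraph.Adj.toWalk, SimpleGraph.Walk.support_cons, SimpleGraph.Walk.support_nil,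
    List.mem_cons, List.not_mem_nil, or_false] at hz
  rcases hz with rfl | rfl <;> assumption

theorem exists_path (h : LinkedIn S p q) :
    ∃ P : (grid ℓ).Path p q, ∀ z ∈ P.1.support, S (z.1 : ℕ) (z.2 : ℕ) := by
  classical
  obtain ⟨w, hw⟩ := h
  exact ⟨w.toPath, fun z hz => hw z (w.support_toPath_subset_support hz)⟩

end LinkedIn

theorem grid_adj_iff {ℓ : ℕ} {p q : GridVertex ℓ} : (grid ℓ).Adj p q ↔
    (((p.1 : ℕ) + 1 = q.1 ∨ (q.1 : ℕ) + 1 = p.1) ∧ (p.2 : ℕ) = q.2) ∨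
      (((p.2 : ℕ) + 1 = q.2 ∨ (q.2 : ℕ) + 1 = p.2) ∧ (p.1 : ℕ) = q.1) := by
  simp only [grid, SimpleGraph.boxProd_adj, SimpleGraph.pathGraph_adj, Fin.ext_iff]

theorem two_le_grid_dist {ℓ : ℕ} {p q : GridVertex ℓ}
    (h : 2 ≤ |((p.1 : ℕ) : ℤ) - (q.1 : ℕ)| + |((p.2 : ℕ) : ℤ) - (q.2 : ℕ)|) :
    2 ≤ (grid ℓ).dist p q := by
  obtain ⟨n, rfl⟩ : ∃ n, ℓ = n + 1 := ⟨ℓ - 1, by have := p.1.2; omega⟩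
  have hconn : (grid (n + 1)).Connected :=
    (SimpleGraph.pathGraph_connected n).boxProd (SimpleGraph.pathGraph_connected n)
  by_contra! hlt
  rcases Nat.lt_or_ge 0 ((grid (n + 1)).dist p q) with h0 | h0
  · have hadj := grid_adj_iff.1 (SimpleGraph.dist_eq_one_iff_adj.1 (by omega :
      (grid (n + 1)).dist p q = 1))
    simp only [abs_eq_max_neg] at h
    omega
  · have := (hconn.dist_eq_zero_iff (u := p) (v := q)).1 (by omega)
    subst this
    simp at h

/-- The vertex of the grid with given row and column, provided that these are in range. -/
def gridPoint (ℓ : ℕ) [NeZero ℓ] (y x : ℤ) : GridVertex ℓ :=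
  (Fin.ofNat ℓ y.toNat, Fin.ofNat ℓ x.toNat)

theorem gridPoint_fst {ℓ : ℕ} [NeZero ℓ] {y : ℤ} (x : ℤ) (h : 0 ≤ y ∧ y < ℓ) :
    (((gridPoint ℓ y x).1 : ℕ) : ℤ) = y := by
  have : y.toNat % ℓ = y.toNat := Nat.mod_eq_of_lt (by omega)
  simp only [gridPoint, Fin.ofNat, this]
  omega

theorem gridPoint_snd {ℓ : ℕ} [NeZero ℓ] (y : ℤ) {x : ℤ} (h : 0 ≤ x ∧ x < ℓ) :
    (((gridPoint ℓ y x).2 : ℕ) : ℤ) = x := by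
  have : x.toNat % ℓ = x.toNat := Nat.mod_eq_of_lt (by omega)
  simp only [gridPoint, Fin.ofNat, this]
  omega

section Linking

variable {ℓ : ℕ} [NeZero ℓ] {S : ℤ → ℤ → Prop}

theorem linkedIn_step (hS : ∀ y x, S y x → (0 ≤ y ∧ y < ℓ) ∧ 0 ≤ x ∧ x < ℓ)
    {y x y' x' : ℤ} (h : S y x) (h' : S y' x')
    (hd : |y - y'| + |x - x'| ≤ 1) : LinkedIn S (gridPoint ℓ y x) (gridPoint ℓ y' x') := by
  have e1 := gridPoint_fst x (hS y x h).1
  have e2 := gridPoint_snd y (hS y x h).2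
  have e3 := gridPoint_fst x' (hS y' x' h').1
  have e4 := gridPoint_snd y' (hS y' x' h').2
  by_cases heq : y = y' ∧ x = x'
  · obtain ⟨rfl, rfl⟩ := heq
    exact .refl (by rwa [e1, e2])
  · refine .of_adj (grid_adj_iff.2 ?_) (by rwa [e1, e2]) (by rwa [e3, e4])
    simp only [abs_eq_max_neg] at hd
    omega

theorem linkedIn_vertical (hS : ∀ y x, S y x → (0 ≤ y ∧ y < ℓ) ∧ 0 ≤ x ∧ x < ℓ)
    {x y : ℤ} (n : ℕ) (h : ∀ k : ℕ, k ≤ n → S (y + k) x) :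
    LinkedIn S (gridPoint ℓ y x) (gridPoint ℓ (y + n) x) := by
  induction n with
  | zero => simpa using linkedIn_step hS (h 0 le_rfl) (h 0 le_rfl) (by simp)
  | succ n ih =>
    refine (ih fun k hk => h k (by omega)).trans
      (linkedIn_step hS (h n (by omega)) (h (n + 1) le_rfl) ?_)
    push_cast
    simp

/-- A diagonal step of the graph is replaced by a horizontal step followed by a vertical one; `h'`
admits the corner between them. This is why `lineRegion` contains the points in row `g (x - 1)` of
column `x`. -/
theorem linkedIn_graph (hS : ∀ y x, S y x → (0 ≤ y ∧ y < ℓ) ∧ 0 ≤ x ∧ x < ℓ)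
    {g : ℤ → ℤ} (hg : ∀ x y, |g x - g y| ≤ |x - y|) {x : ℤ} (n : ℕ)
    (h : ∀ k : ℕ, k ≤ n → S (g (x + k)) (x + k))
    (h' : ∀ k : ℕ, k < n → S (g (x + k)) (x + k + 1)) :
    LinkedIn S (gridPoint ℓ (g x) x) (gridPoint ℓ (g (x + n)) (x + n)) := by
  induction n with
  | zero => simpa using linkedIn_step hS (h 0 le_rfl) (h 0 le_rfl) (by simp)
  | succ n ih =>
    refine ((ih (fun k hk => h k (by omega)) fun k hk => h' k (by omega)).trans
      (linkedIn_step hS (h n (by omega)) (h' n (by omega)) (by simp))).trans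
      (linkedIn_step hS (h' n (by omega)) (h (n + 1) le_rfl) ?_)
    have := hg (x + n) (x + (n + 1 : ℕ))
    push_cast at this ⊢
    have e : x + (n : ℤ) - (x + (n + 1)) = -1 := by ring
    have e' : x + (n : ℤ) + 1 - (x + (n + 1)) = 0 := by ring
    rw [e] at this
    rw [e']
    simpa using this

end Linking

/-! ### Nested lines between two rows. -/

/-- The region of one line of the routing: along the graph of `g` to column `X`, along this column,
and back along the graph of `g'`. -/
def lineRegion (g g' : ℤ → ℤ) (X : ℤ) (y x : ℤ) : Prop :=
  (1 ≤ x ∧ x ≤ X ∧ (y = g x ∨ y = g (x - 1))) ∨ (x = X ∧ g X ≤ y ∧ y ≤ g' X) ∨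
    (1 ≤ x ∧ x ≤ X ∧ (y = g' x ∨ y = g' (x - 1)))

theorem linkedIn_lineRegion {ℓ : ℕ} [NeZero ℓ] {g g' : ℤ → ℤ} {X c c' : ℤ}
    (hg : ∀ x y, |g x - g y| ≤ |x - y|) (hg' : ∀ x y, |g' x - g' y| ≤ |x - y|)
    (hS : ∀ y x, lineRegion g g' X y x → (0 ≤ y ∧ y < ℓ) ∧ 0 ≤ x ∧ x < ℓ)
    (hc : 1 ≤ c ∧ c ≤ X) (hc' : 1 ≤ c' ∧ c' ≤ X) (hX : g X ≤ g' X) :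
    LinkedIn (lineRegion g g' X) (gridPoint ℓ (g c) c) (gridPoint ℓ (g' c') c') := by
  obtain ⟨n, hn⟩ := Int.eq_ofNat_of_zero_le (sub_nonneg.2 hc.2)
  obtain ⟨n', hn'⟩ := Int.eq_ofNat_of_zero_le (sub_nonneg.2 hc'.2)
  obtain ⟨k, hk⟩ := Int.eq_ofNat_of_zero_le (sub_nonneg.2 hX)
  have h1 : LinkedIn (lineRegion g g' X) (gridPoint ℓ (g c) c) (gridPoint ℓ (g X) X) := by
    have := linkedIn_graph hS hg (x := c) n
      (fun k hk => Or.inl ⟨by omega, by omega, Or.inl rfl⟩)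
      (fun k hk => Or.inl ⟨by omega, by omega, Or.inr (by rw [add_sub_cancel_right])⟩)
    rwa [← hn, add_sub_cancel] at this
  have h2 : LinkedIn (lineRegion g g' X) (gridPoint ℓ (g' c') c') (gridPoint ℓ (g' X) X) := by
    have := linkedIn_graph hS hg' (x := c') n'
      (fun k hk => Or.inr (Or.inr ⟨by omega, by omega, Or.inl rfl⟩))
      (fun k hk => Or.inr (Or.inr ⟨by omega, by omega, Or.inr (by rw [add_sub_cancel_right])⟩))
    rwa [← hn', add_sub_cancel] at this
  have h3 : LinkedIn (lineRegion g g' X) (gridPoint ℓ (g X) X) (gridPoint ℓ (g' X) X) := by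
    have := linkedIn_vertical hS (x := X) (y := g X) k
      (fun k hk => Or.inr (Or.inl ⟨rfl, by omega, by omega⟩))
    rwa [← hk, add_sub_cancel] at this
  exact (h1.trans h3).trans h2.symm

/-- Two line regions are at distance at least `2` if the graphs of the second lie strictly inside
those of the first. -/
theorem lineRegion_separated {f f' : ℤ → ℤ} {a b p q m X X' : ℤ}
    (hf : ∀ x y, |f x - f y| ≤ |x - y|) (hf' : ∀ x y, |f' x - f' y| ≤ |x - y|)
    (hfm : ∀ x, 0 ≤ f x ∧ f x ≤ 4 * m) (hfm' : ∀ x, 0 ≤ f' x ∧ f' x ≤ 4 * m)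
    (hpq : p < q) (hq : q ≤ m) (hX : X' + 4 ≤ X) (hab : a + 16 * m + 4 ≤ b)
    {y x y' x' : ℤ}
    (h : lineRegion (fun x => a + 4 * p - f x) (fun x => b - 4 * p + f' x) X y x)
    (h' : lineRegion (fun x => a + 4 * q - f x) (fun x => b - 4 * q + f' x) X' y' x') :
    2 ≤ |y - y'| + |x - x'| := by
  by_contra! hlt
  simp only [lineRegion] at h h'
  have b1 := hfm x
  have b2 := hfm (x - 1)
  have b3 := hfm x'
  have b4 := hfm (x' - 1)
  have b5 := hfm' x
  have b6 := hfm' (x - 1)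
  have b7 := hfm' x'
  have b8 := hfm' (x' - 1)
  have l1 := hf x x'
  have l2 := hf x (x' - 1)
  have l3 := hf (x - 1) x'
  have l4 := hf (x - 1) (x' - 1)
  have k1 := hf' x x'
  have k2 := hf' x (x' - 1)
  have k3 := hf' (x - 1) x'
  have k4 := hf' (x - 1) (x' - 1)
  -- Points at distance at most `1` lie in columns at most `1` apart, so the arguments of `f` (and
  -- of `f'`) differ by at most `2`, and so do the values. The offsets of corresponding curves
  -- differ by at least `4`, which leaves a vertical distance of at least `2`.
  have hx : -1 ≤ x - x' ∧ x - x' ≤ 1 := by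
    simp only [abs_eq_max_neg] at hlt; omega
  have hy : -1 ≤ y - y' ∧ y - y' ≤ 1 := by
    simp only [abs_eq_max_neg] at hlt; omega
  have m1 : |x - x'| ≤ 1 := abs_le.2 hx
  have m2 : |x - (x' - 1)| ≤ 2 := abs_le.2 (by omega)
  have m3 : |x - 1 - x'| ≤ 2 := abs_le.2 (by omega)
  have m4 : |x - 1 - (x' - 1)| ≤ 1 := abs_le.2 (by omega)
  replace l1 := abs_le.1 (l1.trans m1)
  replace l2 := abs_le.1 (l2.trans m2)
  replace l3 := abs_le.1 (l3.trans m3)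
  replace l4 := abs_le.1 (l4.trans m4)
  replace k1 := abs_le.1 (k1.trans m1)
  replace k2 := abs_le.1 (k2.trans m2)
  replace k3 := abs_le.1 (k3.trans m3)
  replace k4 := abs_le.1 (k4.trans m4)
  clear m1 m2 m3 m4 hf hf' hfm hfm' hlt
  rcases h with ⟨-, h1, h2⟩ | ⟨h1, h2, h3⟩ | ⟨-, h1, h2⟩ <;>
  rcases h' with ⟨-, h1', h2'⟩ | ⟨h1', h2', h3'⟩ | ⟨-, h1', h2'⟩
  · omega
  · subst h1'; omega
  · omega
  · omega
  · omega
  · omega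
  · omega
  · subst h1'; omega
  · omega

/-- Routing of demand pairs between two rows of the grid: if the pairs can be numbered so that the
numbers of any two of them differ by at most a quarter of the distance of their terminals, on either
row, and the rows and terminals are far from each other and from the boundary, then the pairs are
routed by paths at distance at least `2` from each other that avoid the boundary. -/
theorem exists_spacedOut_paths_of_lt {ℓ : ℕ} {ι : Type*} [Finite ι] (s t : ι → GridVertex ℓ)
    (a b m : ℕ) (ha : ∀ i, ((s i).1 : ℕ) = a) (hb : ∀ i, ((t i).1 : ℕ) = b) (lam : ι → ℕ)
    (hinj : Function.Injective lam) (hm : ∀ i, lam i ≤ m)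
    (hs : ∀ i j, 4 * |(lam i : ℤ) - lam j| ≤ |((s i).2 : ℕ) - (((s j).2 : ℕ) : ℤ)|)
    (ht : ∀ i j, 4 * |(lam i : ℤ) - lam j| ≤ |((t i).2 : ℕ) - (((t j).2 : ℕ) : ℤ)|)
    (hsb : ∀ i, 1 ≤ ((s i).2 : ℕ) ∧ ((s i).2 : ℕ) + 4 * m + 2 ≤ ℓ)
    (htb : ∀ i, 1 ≤ ((t i).2 : ℕ) ∧ ((t i).2 : ℕ) + 4 * m + 2 ≤ ℓ)
    (ha0 : 4 * m + 1 ≤ a) (hbl : b + 4 * m + 2 ≤ ℓ) (hab : a + 16 * m + 4 ≤ b) :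
    ∃ P : ∀ i, (grid ℓ).Path (s i) (t i),
      (∀ i j, i ≠ j → ∀ x ∈ (P i).1.support, ∀ y ∈ (P j).1.support, 2 ≤ (grid ℓ).dist x y) ∧
        ∀ i, ∀ x ∈ (P i).1.support, ¬ OnBoundary x := by
  have : NeZero ℓ := ⟨by omega⟩
  have hlip : ∀ i j, |(4 * lam i : ℤ) - 4 * lam j| = 4 * |(lam i : ℤ) - lam j| := fun i j => by
    rw [← mul_sub, abs_mul]; rfl
  obtain ⟨f, hf, hfs, hfm⟩ := exists_lipschitz_extension (fun i => (((s i).2 : ℕ) : ℤ))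
    (fun i => 4 * (lam i : ℤ)) (4 * m) (by positivity) (fun i j => (hlip i j).trans_le (hs i j))
    (fun i => by positivity) (fun i => by have := hm i; omega)
  obtain ⟨f', hf', hft, hfm'⟩ := exists_lipschitz_extension (fun i => (((t i).2 : ℕ) : ℤ))
    (fun i => 4 * (lam i : ℤ)) (4 * m) (by positivity) (fun i j => (hlip i j).trans_le (ht i j))
    (fun i => by positivity) (fun i => by have := hm i; omega)
  -- The turning columns start one column before the last one, off the boundary, and are spaced by
  -- `4`; since `lam i ≤ m`, they all lie to the right of the terminals.
  let X : ι → ℤ := fun i => ℓ - 2 - 4 * lam i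
  let S : ι → ℤ → ℤ → Prop := fun i =>
    lineRegion (fun x => a + 4 * lam i - f x) (fun x => b - 4 * lam i + f' x) (X i)
  have hS : ∀ i y x, S i y x → (0 < y ∧ y < ℓ - 1) ∧ 0 < x ∧ x < ℓ - 1 := by
    intro i y x h
    have b1 := hfm x
    have b2 := hfm (x - 1)
    have b5 := hfm' x
    have b6 := hfm' (x - 1)
    have := hm i
    simp only [S, X, lineRegion] at h
    rcases h with ⟨h0, h1, h2 | h2⟩ | ⟨h1, h2, h3⟩ | ⟨h0, h1, h2 | h2⟩
    · omega
    · omega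
    · rw [← h1] at h2 h3
      omega
    · omega
    · omega
  have hlink : ∀ i, LinkedIn (S i) (s i) (t i) := by
    intro i
    have := hm i
    have h := linkedIn_lineRegion (ℓ := ℓ) (g := fun x => a + 4 * lam i - f x)
      (g' := fun x => b - 4 * lam i + f' x) (X := X i) (c := ((s i).2 : ℕ))
      (c' := ((t i).2 : ℕ))
      (fun x y => by have := hf y x; rw [abs_sub_comm y x] at this; convert this using 2; ring)
      (fun x y => by have := hf' x y; convert this using 2; ring)
      (fun y x h => by have := hS i y x h; omega)
      (by have := hsb i; simp only [X]; omega) (by have := htb i; simp only [X]; omega)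
      (by have := (hfm (X i)).1; have := (hfm' (X i)).1; omega)
    -- At its own terminals the offset `4 * lam i` cancels against `f` and `f'`, so the line is
    -- exactly in row `a`, respectively `b`.
    rw [hfs i, hft i, add_sub_cancel_right, sub_add_cancel] at h
    have e1 : gridPoint ℓ a ((s i).2 : ℕ) = s i := by
      ext
      · have := gridPoint_fst (ℓ := ℓ) (y := a) ((s i).2 : ℕ) (by omega)
        have := ha i
        omega
      · have := gridPoint_snd (ℓ := ℓ) (a : ℤ) (x := ((s i).2 : ℕ)) (by omega)
        omega
    have e2 : gridPoint ℓ b ((t i).2 : ℕ) = t i := by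
      ext
      · have := gridPoint_fst (ℓ := ℓ) (y := b) ((t i).2 : ℕ) (by omega)
        have := hb i
        omega
      · have := gridPoint_snd (ℓ := ℓ) (b : ℤ) (x := ((t i).2 : ℕ)) (by omega)
        omega
    rwa [e1, e2] at h
  choose P hP using fun i => (hlink i).exists_path
  have key : ∀ i j, lam i < lam j → ∀ x ∈ (P i).1.support, ∀ y ∈ (P j).1.support,
      2 ≤ (grid ℓ).dist x y := by
    intro i j hij x hx y hy
    have := hm j
    exact two_le_grid_dist (lineRegion_separated (m := m) hf hf' hfm hfm' (by omega)
      (by omega) (by simp only [X]; omega) (by omega) (hP i x hx) (hP j y hy))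
  refine ⟨P, fun i j hij x hx y hy => ?_, fun i x hx hbd => ?_⟩
  · rcases lt_or_gt_of_ne (hinj.ne hij) with h | h
    · exact key i j h x hx y hy
    · rw [SimpleGraph.dist_comm]
      exact key j i h y hy x hx
  · have := hS i _ _ (hP i x hx)
    simp only [OnBoundary] at hbd
    omega

/-- The condition is symmetric in sources and destinations, so when the destination row has the
smaller index the paths are built backwards and reversed. -/
theorem exists_spacedOut_paths {ℓ : ℕ} {ι : Type*} [Finite ι] (s t : ι → GridVertex ℓ)
    (a b m : ℕ) (ha : ∀ i, ((s i).1 : ℕ) = a) (hb : ∀ i, ((t i).1 : ℕ) = b) (lam : ι → ℕ)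
    (hinj : Function.Injective lam) (hm : ∀ i, lam i ≤ m)
    (hs : ∀ i j, 4 * |(lam i : ℤ) - lam j| ≤ |((s i).2 : ℕ) - (((s j).2 : ℕ) : ℤ)|)
    (ht : ∀ i j, 4 * |(lam i : ℤ) - lam j| ≤ |((t i).2 : ℕ) - (((t j).2 : ℕ) : ℤ)|)
    (hsb : ∀ i, 1 ≤ ((s i).2 : ℕ) ∧ ((s i).2 : ℕ) + 4 * m + 2 ≤ ℓ)
    (htb : ∀ i, 1 ≤ ((t i).2 : ℕ) ∧ ((t i).2 : ℕ) + 4 * m + 2 ≤ ℓ)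
    (ha0 : 4 * m + 1 ≤ a) (hal : a + 4 * m + 2 ≤ ℓ) (hb0 : 4 * m + 1 ≤ b)
    (hbl : b + 4 * m + 2 ≤ ℓ) (hab : a + 16 * m + 4 ≤ b ∨ b + 16 * m + 4 ≤ a) :
    ∃ P : ∀ i, (grid ℓ).Path (s i) (t i),
      (∀ i j, i ≠ j → ∀ x ∈ (P i).1.support, ∀ y ∈ (P j).1.support, 2 ≤ (grid ℓ).dist x y) ∧
        ∀ i, ∀ x ∈ (P i).1.support, ¬ OnBoundary x := by
  rcases hab with hab | hab
  · exact exists_spacedOut_paths_of_lt s t a b m ha hb lam hinj hm hs ht hsb htb ha0 hbl hab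
  · obtain ⟨P, h1, h2⟩ :=
      exists_spacedOut_paths_of_lt t s b a m hb ha lam hinj hm ht hs htb hsb hb0 hal hab
    exact ⟨fun i => (P i).reverse, by simpa using h1, by simpa using h2⟩

/-! ### Ranks and equally spaced terminals. -/

/-- The rank of `k` among the keys of the elements of `s`. -/
def keyRank {α κ : Type*} [LinearOrder κ] (s : Finset α) (key : α → κ) (k : κ) : ℕ :=
  (s.filter fun x => key x < k).card

section KeyRank

variable {α κ : Type*} [LinearOrder κ] {s : Finset α} {key : α → κ}

theorem keyRank_le_card (k : κ) : keyRank s key k ≤ s.card := Finset.card_filter_le _ _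

theorem keyRank_add_card {k k' : κ} (h : k ≤ k') :
    keyRank s key k + (s.filter fun x => k ≤ key x ∧ key x < k').card = keyRank s key k' := by
  classical
  unfold keyRank
  rw [← Finset.card_union_of_disjoint]
  · congr 1
    ext x
    simp only [Finset.mem_union, Finset.mem_filter]
    constructor
    · rintro (⟨h1, h2⟩ | ⟨h1, -, h2⟩)
      exacts [⟨h1, h2.trans_le h⟩, ⟨h1, h2⟩]
    · rintro ⟨h1, h2⟩
      rcases lt_or_ge (key x) k with h3 | h3
      exacts [Or.inl ⟨h1, h3⟩, Or.inr ⟨h1, h3, h2⟩]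
  · rw [Finset.disjoint_left]
    intro x hx hx'
    exact (Finset.mem_filter.1 hx').2.1.not_gt (Finset.mem_filter.1 hx).2

theorem keyRank_mono {k k' : κ} (h : k ≤ k') : keyRank s key k ≤ keyRank s key k' := by
  have := keyRank_add_card (s := s) (key := key) h
  omega

theorem keyRank_lt {x : α} (hx : x ∈ s) {k : κ} (h : key x < k) :
    keyRank s key (key x) < keyRank s key k := by
  have := keyRank_add_card (s := s) (key := key) h.le
  have : 0 < (s.filter fun y => key x ≤ key y ∧ key y < k).card :=
    Finset.card_pos.2 ⟨x, by simp [hx, h]⟩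
  omega

end KeyRank

theorem keyRank_max_add_one {α : Type*} {n : ℕ} {pos : α → Fin n} (hpos : Function.Injective pos)
    {s : Finset α} {m : α} (hm : m ∈ s) (hmax : ∀ x ∈ s, pos x ≤ pos m) :
    keyRank s pos (pos m) + 1 = s.card := by
  classical
  unfold keyRank
  rw [← Finset.card_erase_add_one hm]
  congr 2
  ext x
  simp only [Finset.mem_filter, Finset.mem_erase]
  exact ⟨fun h => ⟨fun hx => lt_irrefl _ (hx ▸ h.2), h.1⟩,
    fun h => ⟨h.2, lt_of_le_of_ne (hmax x h.2) fun hx => h.1 (hpos hx)⟩⟩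

/-- If consecutive elements of `s` (in the order given by `pos`) have values of `c` that differ by
exactly `G`, then `c` grows by `G` times the rank. -/
theorem sub_eq_mul_rank {α : Type*} {n : ℕ} (pos : α → Fin n) (hpos : Function.Injective pos)
    (c : α → ℤ) (G : ℤ) (s : Finset α)
    (hc : ∀ u ∈ s, ∀ v ∈ s, pos u < pos v → (∀ w ∈ s, ¬ (pos u < pos w ∧ pos w < pos v)) →
      c v = c u + G) :
    ∀ u ∈ s, ∀ v ∈ s, c v - c u = G * (keyRank s pos (pos v) - keyRank s pos (pos u)) := by
  classical
  induction s using Finset.induction_on_max_value pos with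
  | empty => simp
  | insert a s ha hmax ih =>
    have hlt : ∀ x ∈ s, pos x < pos a := fun x hx =>
      lt_of_le_of_ne (hmax x hx) fun h => ha (hpos h ▸ hx)
    have hrank : ∀ x ∈ s, keyRank (insert a s) pos (pos x) = keyRank s pos (pos x) := by
      intro x hx
      unfold keyRank
      rw [Finset.filter_insert, if_neg (hlt x hx).not_gt]
    have hranka : keyRank (insert a s) pos (pos a) = s.card := by
      unfold keyRank
      rw [Finset.filter_insert, if_neg (lt_irrefl _), Finset.filter_true_of_mem hlt]
    replace ih := ih fun u hu v hv huv h => hc u (Finset.mem_insert_of_mem hu) v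
      (Finset.mem_insert_of_mem hv) huv fun w hw => by
        rcases Finset.mem_insert.1 hw with rfl | hw
        · exact fun h => (hlt v hv).not_gt h.2
        · exact h w hw
    have hstep : ∀ u ∈ s, c a - c u = G * (s.card - keyRank s pos (pos u)) := by
      intro u hu
      -- The predecessor of `a` is the last element of `s`, whose rank is `s.card - 1`.
      obtain ⟨m, hm, hm'⟩ := Finset.exists_max_image s pos ⟨u, hu⟩
      have h1 := hc m (Finset.mem_insert_of_mem hm) a (Finset.mem_insert_self _ _) (hlt m hm)
        fun w hw => by
          rcases Finset.mem_insert.1 hw with rfl | hw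
          · exact fun h => lt_irrefl _ h.2
          · exact fun h => (hm' w hw).not_gt h.1
      have h2 := ih u hu m hm
      have h3 := keyRank_max_add_one hpos hm hm'
      rw [← h3]
      push_cast
      linear_combination h1 + h2
    intro u hu v hv
    rcases Finset.mem_insert.1 hu with rfl | hu' <;> rcases Finset.mem_insert.1 hv with rfl | hv'
    · simp
    · rw [hranka, hrank v hv']
      linear_combination -(hstep v hv')
    · rw [hranka, hrank u hu']
      exact hstep u hu'
    · rw [hrank u hu', hrank v hv']
      exact ih u hu' v hv'

/-! ### Records, and the selection of balanced terminals. -/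

/-- The elements of `s` at which `φ` is at least as large as before. -/
def records {α : Type*} {n : ℕ} (pos : α → Fin n) (φ : α → ℤ) (s : Finset α) : Finset α :=
  s.filter fun u => ∀ v ∈ s, pos v < pos u → φ v ≤ φ u

theorem records_subset {α : Type*} {n : ℕ} (pos : α → Fin n) (φ : α → ℤ) (s : Finset α) :
    records pos φ s ⊆ s := Finset.filter_subset _ _

/-- If `φ` increases by at most `G` from one element to the next, its growth is at most `G` times
the number of records. -/
theorem le_add_mul_card_records {α : Type*} {n : ℕ} (pos : α → Fin n)
    (hpos : Function.Injective pos) (φ : α → ℤ) (G : ℤ) (hG : 0 ≤ G) (s : Finset α)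
    (hφ : ∀ u ∈ s, ∀ v ∈ s, pos u < pos v → (∀ w ∈ s, ¬ (pos u < pos w ∧ pos w < pos v)) →
      φ v ≤ φ u + G) (hs : s.Nonempty) :
    ∃ u ∈ s, ∀ v ∈ s, pos u ≤ pos v ∧ φ v ≤ φ u + G * ((records pos φ s).card - 1) := by
  classical
  induction s using Finset.induction_on_max_value pos with
  | empty => simp at hs
  | insert a s ha hmax ih =>
    have hlt : ∀ x ∈ s, pos x < pos a := fun x hx =>
      lt_of_le_of_ne (hmax x hx) fun h => ha (hpos h ▸ hx)
    rcases s.eq_empty_or_nonempty with rfl | hne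
    · refine ⟨a, by simp, fun v hv => ?_⟩
      have hv' : v = a := by simpa using hv
      subst hv'
      have : records pos φ (insert v ∅) = {v} := by
        ext x
        simp only [records, Finset.mem_filter, insert_empty_eq, Finset.mem_singleton]
        constructor
        · exact fun h => h.1
        · rintro rfl
          simp
      rw [this]
      simp
    obtain ⟨u, hu, hb⟩ := ih (fun u hu v hv huv h => hφ u (Finset.mem_insert_of_mem hu) v
      (Finset.mem_insert_of_mem hv) huv fun w hw => by
        rcases Finset.mem_insert.1 hw with rfl | hw
        · exact fun h => (hlt v hv).not_gt h.2
        · exact h w hw) hne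
    have hsub : records pos φ s ⊆ records pos φ (insert a s) := by
      intro x hx
      simp only [records, Finset.mem_filter, Finset.mem_insert, forall_eq_or_imp] at hx ⊢
      exact ⟨Or.inr hx.1, fun h => ((hlt x hx.1).not_gt h).elim, hx.2⟩
    have hcard : ((records pos φ s).card : ℤ) ≤ (records pos φ (insert a s)).card := by
      exact_mod_cast Finset.card_le_card hsub
    refine ⟨u, Finset.mem_insert_of_mem hu, fun v hv => ?_⟩
    have hold : ∀ v ∈ s, φ v ≤ φ u + G * ((records pos φ (insert a s)).card - 1) := fun v hv =>
      (hb v hv).2.trans (by gcongr)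
    refine ⟨?_, ?_⟩
    · rcases Finset.mem_insert.1 hv with rfl | hv
      exacts [(hlt u hu).le, (hb v hv).1]
    rcases Finset.mem_insert.1 hv with rfl | hv
    · by_cases hrec : v ∈ records pos φ (insert v s)
      · obtain ⟨m, hm, hm'⟩ := Finset.exists_max_image s pos hne
        have h1 := hφ m (Finset.mem_insert_of_mem hm) v (Finset.mem_insert_self _ _) (hlt m hm)
          fun w hw => by
            rcases Finset.mem_insert.1 hw with rfl | hw
            · exact fun h => lt_irrefl _ h.2
            · exact fun h => (hm' w hw).not_gt h.1
        have hnot : v ∉ records pos φ s := fun h => ha (records_subset _ _ _ h)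
        have hcard' : ((records pos φ s).card : ℤ) + 1 ≤ (records pos φ (insert v s)).card := by
          rw [← Nat.cast_one, ← Nat.cast_add, ← Finset.card_insert_of_notMem hnot]
          exact_mod_cast Finset.card_le_card (Finset.insert_subset hrec hsub)
        have h2 := (hb m hm).2
        have h3 := mul_le_mul_of_nonneg_left hcard' hG
        linarith
      -- A last element that is not a record lies below an earlier value, which already satisfies
      -- the bound.
      · simp only [records, Finset.mem_filter, Finset.mem_insert_self, true_and, not_forall] at hrec
        obtain ⟨w, hw, hw', hw''⟩ := hrec
        rcases Finset.mem_insert.1 hw with rfl | hw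
        · exact (lt_irrefl _ hw').elim
        · exact (not_le.1 hw'').le.trans (hold w hw)
    · exact hold v hv

/-- Let terminals `s` have columns `c` with equal gaps `G`, in the order given by `pos`, and let
`lam` be non-decreasing with total growth at most `H`. Then all but `H / G` of the terminals can be
chosen so that `lam` grows no more than `c` between any two of them. -/
theorem exists_balanced_subset {α : Type*} {n : ℕ} (pos : α → Fin n)
    (hpos : Function.Injective pos) (c lam : α → ℤ) (G H : ℤ) (hG : 0 ≤ G) (hH : 0 ≤ H)
    (s : Finset α)
    (hc : ∀ u ∈ s, ∀ v ∈ s, pos u < pos v → (∀ w ∈ s, ¬ (pos u < pos w ∧ pos w < pos v)) →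
      c v = c u + G)
    (hlam : ∀ u ∈ s, ∀ v ∈ s, pos u ≤ pos v → lam u ≤ lam v)
    (hlamH : ∀ u ∈ s, ∀ v ∈ s, lam v - lam u ≤ H) :
    ∃ J ⊆ s, G * (s.card - J.card) ≤ H ∧
      ∀ u ∈ J, ∀ v ∈ J, |lam u - lam v| ≤ |c u - c v| := by
  -- Between two records of `c - lam`, `c` grows at least as much as `lam`. Over all of `s`, `c -
  -- lam` grows by at least `G * (s.card - 1) - H`, but by at most `G` per record after the first.
  refine ⟨records pos (fun u => c u - lam u) s, records_subset _ _ _, ?_, ?_⟩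
  · rcases s.eq_empty_or_nonempty with rfl | hne
    · simpa [records] using hH
    obtain ⟨u, hu, hb⟩ := le_add_mul_card_records pos hpos (fun u => c u - lam u) G hG s
      (fun u hu v hv huv h => by
        have := hc u hu v hv huv h
        have := hlam u hu v hv huv.le
        linarith) hne
    obtain ⟨m, hm, hm'⟩ := Finset.exists_max_image s pos hne
    have h1 := sub_eq_mul_rank pos hpos c G s hc u hu m hm
    have h2 := (hb m hm).2
    have h3 := keyRank_max_add_one hpos hm hm'
    have h4 : keyRank s pos (pos u) = 0 := by
      unfold keyRank
      rw [Finset.card_eq_zero, Finset.filter_eq_empty_iff]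
      exact fun x hx => not_lt.2 (hb x hx).1
    have h5 := hlamH u hu m hm
    rw [h4, Nat.cast_zero, sub_zero] at h1
    rw [← h3]
    push_cast
    linarith
  · have key : ∀ u ∈ records pos (fun u => c u - lam u) s,
        ∀ v ∈ records pos (fun u => c u - lam u) s, pos u < pos v →
          |lam u - lam v| ≤ |c u - c v| := by
      intro u hu v hv huv
      simp only [records, Finset.mem_filter] at hu hv
      have h1 := hv.2 u hu.1 huv
      have h2 := hlam u hu.1 v hv.1 huv.le
      rw [abs_sub_comm, abs_of_nonneg (sub_nonneg.2 h2), abs_sub_comm]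
      exact le_trans (by linarith) (le_abs_self _)
    intro u hu v hv
    rcases lt_trichotomy (pos u) (pos v) with h | h | h
    · exact key u hu v hv h
    · rw [hpos h]; simp
    · rw [abs_sub_comm, abs_sub_comm (c u)]
      exact key v hv u hu h

/-! ### Numbering the edges of a perfect solution. -/

namespace GPwB

variable {V₁ V₂ : Type*} [Fintype V₁] [DecidableEq V₁] [Fintype V₂] [DecidableEq V₂]
  {I : GPwB V₁ V₂}

theorem Valid.r_mul_h (hI : I.Valid) : I.r * I.h = I.betaStar := by
  have hr : (I.r : ℚ) ≠ 0 := by exact_mod_cast I.r_pos.ne'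
  have := hI.1
  rw [eq_div_iff hr] at this
  rw [mul_comm]
  exact_mod_cast this

theorem one_le_logb (hM : 2 ≤ I.M) : 1 ≤ Real.logb 2 (I.M : ℝ) := by
  rw [Real.le_logb_iff_rpow_le (by norm_num) (by positivity)]
  simpa using (by exact_mod_cast hM : (2 : ℝ) ≤ I.M)

/-- The gaps of a block add up to a large multiple of `h`, the most that the rank can grow along it.
-/
theorem mul_h_le_gap_mul (hM : 2 ≤ I.M) {β : ℕ} (hβ : 0 < β) : 512 * I.h ≤ I.gap β * β := by
  have hlog := one_le_logb hM
  have hβ' : (0 : ℝ) < β := by exact_mod_cast hβ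
  have h1 := Nat.le_ceil ((I.h : ℝ) * Real.logb 2 I.M / β)
  rw [div_le_iff₀ hβ'] at h1
  have h2 : (I.h : ℝ) ≤ (I.h : ℝ) * Real.logb 2 I.M := le_mul_of_one_le_right (by positivity) hlog
  have h3 : (I.h : ℝ) ≤ (⌈(I.h : ℝ) * Real.logb 2 I.M / β⌉₊ : ℝ) * β := h2.trans h1
  have h4 : I.h ≤ ⌈(I.h : ℝ) * Real.logb 2 I.M / β⌉₊ * β := by exact_mod_cast h3
  unfold gap
  rw [mul_assoc]
  exact Nat.mul_le_mul_left _ h4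

theorem le_gap (hM : 2 ≤ I.M) {β : ℕ} (hβ : 0 < β) : 512 ≤ I.gap β := by
  have hlog := one_le_logb hM
  have hh : (0 : ℝ) < I.h := by exact_mod_cast I.h_pos
  have hβ' : (0 : ℝ) < β := by exact_mod_cast hβ
  have : 0 < ⌈(I.h : ℝ) * Real.logb 2 I.M / β⌉₊ := Nat.ceil_pos.2 (by positivity)
  unfold gap
  omega

theorem le_side (hM : 2 ≤ I.M) : 4096 * I.M ≤ I.side := by
  have hlog := one_le_logb hM
  have h1 : (I.M : ℝ) ^ 2 ≤ (I.M : ℝ) ^ 2 * Real.logb 2 I.M :=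
    le_mul_of_one_le_right (by positivity) hlog
  have h2 : ((I.M ^ 2 : ℕ) : ℝ) ≤ (⌈(I.M : ℝ) ^ 2 * Real.logb 2 I.M⌉₊ : ℝ) := by
    push_cast
    exact h1.trans (Nat.le_ceil _)
  have h3 : I.M ^ 2 ≤ ⌈(I.M : ℝ) ^ 2 * Real.logb 2 I.M⌉₊ := by exact_mod_cast h2
  unfold side
  nlinarith

theorem groupOf_eq_iff {V : Type*} [Fintype V] [DecidableEq V]
    {P : Finpartition (Finset.univ : Finset V)} {v : V} {U : {U : Finset V // U ∈ P.parts}} :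
    groupOf P v = U ↔ v ∈ U.1 := by
  constructor
  · rintro rfl
    exact P.mem_part (Finset.mem_univ v)
  · intro h
    exact Subtype.ext (P.part_eq_of_mem U.2 h)

theorem groupOf_mem_bundleGroups₁ {e : V₁ × V₂} (he : e ∈ I.edges) :
    groupOf I.groups₂ e.2 ∈ I.bundleGroups₁ e.1 := by
  simp only [bundleGroups₁, Finset.mem_filter, Finset.mem_univ, true_and]
  exact ⟨e, by simp [bundle₁, he, groupOf_eq_iff.1 rfl]⟩

theorem groupOf_mem_bundleGroups₂ {e : V₁ × V₂} (he : e ∈ I.edges) :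
    groupOf I.groups₁ e.1 ∈ I.bundleGroups₂ e.2 := by
  simp only [bundleGroups₂, Finset.mem_filter, Finset.mem_univ, true_and]
  exact ⟨e, by simp [bundle₂, he, groupOf_eq_iff.1 rfl]⟩

theorem beta₁_pos {v : V₁} (h : (I.bundleGroups₁ v).Nonempty) : 0 < I.beta₁ v :=
  Finset.card_pos.2 (h.image _)

theorem beta₂_pos {v : V₂} (h : (I.bundleGroups₂ v).Nonempty) : 0 < I.beta₂ v :=
  Finset.card_pos.2 (h.image _)

namespace Solution

variable (S : I.Solution)

/-- The edges of all clusters of a solution. -/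
def allEdges : Finset (V₁ × V₂) := Finset.univ.biUnion S.E

variable {S}

theorem mem_E_of_mem_allEdges {e : V₁ × V₂} (he : e ∈ S.allEdges) :
    e ∈ S.E (S.W (Sum.inl e.1)) := by
  obtain ⟨i, -, hi⟩ := Finset.mem_biUnion.1 he
  rwa [(S.E_inside i e hi).1]

theorem W_inr_of_mem_allEdges {e : V₁ × V₂} (he : e ∈ S.allEdges) :
    S.W (Sum.inr e.2) = S.W (Sum.inl e.1) :=
  (S.E_inside _ e (mem_E_of_mem_allEdges he)).2

theorem mem_edges_of_mem_allEdges {e : V₁ × V₂} (he : e ∈ S.allEdges) : e ∈ I.edges :=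
  S.E_sub _ (mem_E_of_mem_allEdges he)

theorem card_allEdges_le : S.allEdges.card ≤ I.M :=
  Finset.card_le_card fun _ he => mem_edges_of_mem_allEdges he

theorem Perfect.card_allEdges (hS : S.Perfect) (hI : I.Valid) :
    S.allEdges.card = I.betaStar := by
  rw [allEdges, Finset.card_biUnion]
  · simp only [hS.2.2, Finset.sum_const, Finset.card_univ, Fintype.card_fin, smul_eq_mul]
    exact hI.r_mul_h
  · intro i _ j _ hij
    refine Finset.disjoint_left.2 fun e he he' => hij ?_
    exact ((S.E_inside i e he).1.symm.trans (S.E_inside j e he').1)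

theorem Perfect.eq_of_groupOf₁ (hS : S.Perfect) {u v : V₁}
    (hW : S.W (Sum.inl u) = S.W (Sum.inl v)) (h : groupOf I.groups₁ u = groupOf I.groups₁ v) :
    u = v :=
  (hS.1 _ (groupOf I.groups₁ v).2 (S.W (Sum.inl v))).unique ⟨groupOf_eq_iff.1 h, hW⟩
    ⟨groupOf_eq_iff.1 rfl, rfl⟩

theorem Perfect.eq_of_groupOf₂ (hS : S.Perfect) {u v : V₂}
    (hW : S.W (Sum.inr u) = S.W (Sum.inr v)) (h : groupOf I.groups₂ u = groupOf I.groups₂ v) :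
    u = v :=
  (hS.2.1 _ (groupOf I.groups₂ v).2 (S.W (Sum.inr v))).unique ⟨groupOf_eq_iff.1 h, hW⟩
    ⟨groupOf_eq_iff.1 rfl, rfl⟩

variable (S) (ρ : GroupOrder I.groups₁) (ρ' : GroupOrder I.groups₂)

/-- The key by which the edges of a solution are ordered: first the cluster, then the group in `V₂`,
then the group in `V₁`. -/
def bundleKey (v : V₁) (U : {U : Finset V₂ // U ∈ I.groups₂.parts}) :
    Fin I.r ×ₗ (Fin I.groups₂.parts.card ×ₗ Fin I.groups₁.parts.card) :=
  toLex (S.W (Sum.inl v), toLex (ρ' U, ρ (groupOf I.groups₁ v)))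

/-- The key of an edge. -/
def edgeKey (e : V₁ × V₂) :
    Fin I.r ×ₗ (Fin I.groups₂.parts.card ×ₗ Fin I.groups₁.parts.card) :=
  S.bundleKey ρ ρ' e.1 (groupOf I.groups₂ e.2)

/-- The number of edges of the solution before a bundle. -/
def bundleRank (v : V₁) (U : {U : Finset V₂ // U ∈ I.groups₂.parts}) : ℕ :=
  keyRank S.allEdges (S.edgeKey ρ ρ') (S.bundleKey ρ ρ' v U)

variable {S ρ ρ'}

/-- The key records the cluster and both groups, and a cluster of a perfect solution has only one
vertex in each group. -/
theorem Perfect.edgeKey_injOn (hS : S.Perfect) :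
    Set.InjOn (S.edgeKey ρ ρ') (S.allEdges : Set (V₁ × V₂)) := by
  intro e he e' he' h
  have h' : (S.W (Sum.inl e.1), toLex (ρ' (groupOf I.groups₂ e.2), ρ (groupOf I.groups₁ e.1))) =
      (S.W (Sum.inl e'.1), toLex (ρ' (groupOf I.groups₂ e'.2), ρ (groupOf I.groups₁ e'.1))) :=
    toLex.injective h
  obtain ⟨h1, h2⟩ := Prod.mk.inj h'
  obtain ⟨h3, h4⟩ := Prod.mk.inj (toLex.injective h2)
  refine Prod.ext (hS.eq_of_groupOf₁ h1 (ρ.injective h4)) (hS.eq_of_groupOf₂ ?_ (ρ'.injective h3))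
  rw [W_inr_of_mem_allEdges he, W_inr_of_mem_allEdges he', h1]

theorem Perfect.bundleRank_injOn (hS : S.Perfect) {e e' : V₁ × V₂} (he : e ∈ S.allEdges)
    (he' : e' ∈ S.allEdges) (h : S.bundleRank ρ ρ' e.1 (groupOf I.groups₂ e.2) =
      S.bundleRank ρ ρ' e'.1 (groupOf I.groups₂ e'.2)) : e = e' := by
  apply hS.edgeKey_injOn (ρ := ρ) (ρ' := ρ') he he'
  rcases lt_trichotomy (S.edgeKey ρ ρ' e) (S.edgeKey ρ ρ' e') with hlt | heq | hlt
  · exact absurd h (keyRank_lt (s := S.allEdges) he hlt).ne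
  · exact heq
  · exact absurd h (keyRank_lt (s := S.allEdges) he' hlt).ne'

theorem bundleRank_le (v : V₁) (U) : S.bundleRank ρ ρ' v U ≤ I.M :=
  (keyRank_le_card _).trans card_allEdges_le

theorem bundleKey_mono (v : V₁) {U U'} (h : ρ' U ≤ ρ' U') :
    S.bundleKey ρ ρ' v U ≤ S.bundleKey ρ ρ' v U' := by
  rw [bundleKey, bundleKey, Prod.Lex.toLex_le_toLex, Prod.Lex.toLex_le_toLex]
  rcases h.lt_or_eq with h | h
  · exact Or.inr ⟨rfl, Or.inl h⟩
  · exact Or.inr ⟨rfl, Or.inr ⟨h, le_rfl⟩⟩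

theorem bundleRank_mono (v : V₁) {U U'} (h : ρ' U ≤ ρ' U') :
    S.bundleRank ρ ρ' v U ≤ S.bundleRank ρ ρ' v U' := keyRank_mono (bundleKey_mono v h)

/-- The cluster is the leading coordinate of the key, so every edge counted between two bundles of
`v` belongs to the cluster of `v`, which has at most `h` edges. -/
theorem bundleRank_le_add (v : V₁) (U U') :
    S.bundleRank ρ ρ' v U' ≤ S.bundleRank ρ ρ' v U + I.h := by
  rcases le_total (ρ' U) (ρ' U') with h | h
  · have h1 := keyRank_add_card (s := S.allEdges) (key := S.edgeKey ρ ρ')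
      (bundleKey_mono (S := S) (ρ := ρ) v h)
    refine h1.symm.le.trans (Nat.add_le_add_left
      ((Finset.card_le_card ?_).trans (S.E_card (S.W (Sum.inl v)))) _)
    intro e he
    obtain ⟨he, hl, hr⟩ := Finset.mem_filter.1 he
    have h2 : S.W (Sum.inl v) ≤ S.W (Sum.inl e.1) := Prod.Lex.monotone_fst _ _ hl
    have h3 : S.W (Sum.inl e.1) ≤ S.W (Sum.inl v) := Prod.Lex.monotone_fst _ _ hr.le
    rw [le_antisymm h2 h3]
    exact mem_E_of_mem_allEdges he
  · exact (bundleRank_mono v h).trans (Nat.le_add_right _ _)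

/-- The ranks of two edges of the same vertex of `V₂` differ at most by the number of bundles of this
vertex in between. -/
theorem Perfect.bundleRank_le_add_keyRank (hS : S.Perfect) {e e' : V₁ × V₂}
    (he : e ∈ S.allEdges) (he' : e' ∈ S.allEdges) (h2 : e.2 = e'.2)
    (hlt : S.edgeKey ρ ρ' e < S.edgeKey ρ ρ' e') :
    S.bundleRank ρ ρ' e'.1 (groupOf I.groups₂ e'.2) +
        keyRank (I.bundleGroups₂ e.2) ρ (ρ (groupOf I.groups₁ e.1)) ≤
      S.bundleRank ρ ρ' e.1 (groupOf I.groups₂ e.2) +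
        keyRank (I.bundleGroups₂ e.2) ρ (ρ (groupOf I.groups₁ e'.1)) := by
  have hW : S.W (Sum.inl e.1) = S.W (Sum.inl e'.1) := by
    rw [← W_inr_of_mem_allEdges he, ← W_inr_of_mem_allEdges he', h2]
  have hkey : ∀ f, S.edgeKey ρ ρ' f = toLex (S.W (Sum.inl f.1),
    toLex (ρ' (groupOf I.groups₂ f.2), ρ (groupOf I.groups₁ f.1))) := fun _ => rfl
  have hρ : ρ (groupOf I.groups₁ e.1) ≤ ρ (groupOf I.groups₁ e'.1) := by
    rw [hkey, hkey, hW, h2, Prod.Lex.toLex_lt_toLex, Prod.Lex.toLex_lt_toLex] at hlt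
    have : ρ (groupOf I.groups₁ e.1) < ρ (groupOf I.groups₁ e'.1) := by simpa using hlt
    exact this.le
  have h1 := keyRank_add_card (s := S.allEdges) (key := S.edgeKey ρ ρ') hlt.le
  have h3 := keyRank_add_card (s := I.bundleGroups₂ e.2) (key := ρ) hρ
  have h4 : (S.allEdges.filter fun f => S.edgeKey ρ ρ' e ≤ S.edgeKey ρ ρ' f ∧
      S.edgeKey ρ ρ' f < S.edgeKey ρ ρ' e').card ≤
      ((I.bundleGroups₂ e.2).filter fun U => ρ (groupOf I.groups₁ e.1) ≤ ρ U ∧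
        ρ U < ρ (groupOf I.groups₁ e'.1)).card := by
    have hf : ∀ f ∈ S.allEdges.filter (fun f => S.edgeKey ρ ρ' e ≤ S.edgeKey ρ ρ' f ∧
        S.edgeKey ρ ρ' f < S.edgeKey ρ ρ' e'), f ∈ S.allEdges ∧
        S.W (Sum.inl f.1) = S.W (Sum.inl e.1) ∧ f.2 = e.2 ∧
        ρ (groupOf I.groups₁ e.1) ≤ ρ (groupOf I.groups₁ f.1) ∧
          ρ (groupOf I.groups₁ f.1) < ρ (groupOf I.groups₁ e'.1) := by
      intro f hf
      obtain ⟨hf, hl, hr⟩ := Finset.mem_filter.1 hf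
      have hWf : S.W (Sum.inl f.1) = S.W (Sum.inl e.1) := le_antisymm
        ((Prod.Lex.monotone_fst _ _ hr.le).trans hW.ge) (Prod.Lex.monotone_fst _ _ hl)
      rw [hkey, hkey, hWf, Prod.Lex.toLex_le_toLex] at hl
      rw [hkey, hkey, hWf, ← hW, Prod.Lex.toLex_lt_toLex] at hr
      simp only [lt_self_iff_false, true_and, false_or] at hl hr
      -- An edge `f` between `e` and `e'` is squeezed into their cluster and their group of `V₂`;
      -- perfection then forces `f.2 = e.2`, so `f` is counted by a bundle of this vertex.
      have hg : ρ' (groupOf I.groups₂ f.2) = ρ' (groupOf I.groups₂ e.2) := le_antisymm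
        ((Prod.Lex.monotone_fst _ _ hr.le).trans (by simp [h2])) (Prod.Lex.monotone_fst _ _ hl)
      rw [hg, Prod.Lex.toLex_le_toLex] at hl
      rw [hg, ← h2, Prod.Lex.toLex_lt_toLex] at hr
      simp only [lt_self_iff_false, true_and, false_or] at hl hr
      refine ⟨hf, hWf, hS.eq_of_groupOf₂ ?_ (ρ'.injective hg), hl, hr⟩
      rw [W_inr_of_mem_allEdges hf, W_inr_of_mem_allEdges he, hWf]
    refine Finset.card_le_card_of_injOn (fun f => groupOf I.groups₁ f.1) ?_ ?_
    · intro f hf'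
      obtain ⟨g1, g2, g3, g4, g5⟩ := hf f hf'
      refine Finset.mem_coe.2 (Finset.mem_filter.2 ⟨?_, g4, g5⟩)
      rw [← g3]
      exact groupOf_mem_bundleGroups₂ (mem_edges_of_mem_allEdges g1)
    · intro f hf1 f' hf2 hff
      obtain ⟨-, g2, g3, -⟩ := hf f hf1
      obtain ⟨-, g2', g3', -⟩ := hf f' hf2
      exact Prod.ext (hS.eq_of_groupOf₁ (g2.trans g2'.symm) hff) (g3.trans g3'.symm)
  unfold bundleRank
  change keyRank S.allEdges (S.edgeKey ρ ρ') (S.edgeKey ρ ρ' e') + _ ≤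
    keyRank S.allEdges (S.edgeKey ρ ρ') (S.edgeKey ρ ρ' e) + _
  omega

end Solution

end GPwB

/-! ### Routing half of the solution edges in a given layout. -/

/-- Terminals in different blocks are far from each other. -/
theorem BlocksSeparated.le_abs_sub {ℓ len d n : ℕ} {start : Fin n → ℕ}
    (h : BlocksSeparated ℓ len d start) {i j : Fin n} (hij : i ≠ j) {x y : ℕ}
    (hx : start i ≤ x ∧ x < start i + len) (hy : start j ≤ y ∧ y < start j + len) :
    (d : ℤ) ≤ |(x : ℤ) - y| := by
  rcases lt_or_gt_of_ne hij with hlt | hlt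
  · have := h.1 i j hlt
    rw [abs_sub_comm]
    exact le_trans (by omega) (le_abs_self _)
  · have := h.1 j i hlt
    exact le_trans (by omega) (le_abs_self _)

namespace Layout

variable {V₁ V₂ : Type*} [Fintype V₁] [DecidableEq V₁] [Fintype V₂] [DecidableEq V₂]
  {I : GPwB V₁ V₂} {ρ : GroupOrder I.groups₁} {ρ' : GroupOrder I.groups₂}

open GPwB GPwB.Solution

/-- The bundles of `v` that can be used by a routing: not many are lost. -/
theorem exists_balanced_bundles (L : Layout I ρ ρ') (S : I.Solution) (hM : 2 ≤ I.M) (v : V₁) :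
    ∃ J ⊆ I.bundleGroups₁ v, 2 * (I.bundleGroups₁ v \ J).card ≤ I.beta₁ v ∧
      ∀ U ∈ J, ∀ U' ∈ J, 4 * |(S.bundleRank ρ ρ' v U : ℤ) - S.bundleRank ρ ρ' v U'| ≤
        |((L.colS v U : ℕ) : ℤ) - (L.colS v U' : ℕ)| := by
  -- With `gap` vertices in between, consecutive columns differ by `gap + 1`; the factor `4` is the
  -- spacing of the nested lines. All bundles of `v` take part, including those without a solution
  -- edge, so that the columns are equally spaced.
  obtain ⟨J, hJ, hcard, hbal⟩ := exists_balanced_subset ρ' ρ'.injective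
    (fun U => ((L.colS v U : ℕ) : ℤ)) (fun U => 4 * (S.bundleRank ρ ρ' v U : ℤ))
    (I.gap (I.beta₁ v) + 1) (4 * I.h) (by positivity) (by positivity) (I.bundleGroups₁ v)
    (fun U hU U' hU' hlt hcons => by
      have := L.colS_gap v U U' ⟨hU, hU', hlt, hcons⟩
      push_cast [this]
      ring)
    (fun U _ U' _ hle => by
      have := bundleRank_mono (S := S) (ρ := ρ) v hle
      omega)
    (fun U _ U' _ => by
      have := bundleRank_le_add (S := S) (ρ := ρ) (ρ' := ρ') v U U'
      omega)
  refine ⟨J, hJ, ?_, fun U hU U' hU' => ?_⟩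
  · rcases (I.bundleGroups₁ v).eq_empty_or_nonempty with h0 | hne
    · simp [h0]
    have h1 := Finset.card_sdiff_add_card_eq_card hJ
    rw [← h1] at hcard
    push_cast at hcard
    rw [add_sub_cancel_right] at hcard
    have h2 := mul_h_le_gap_mul hM (beta₁_pos hne)
    -- Losing more than half of the bundles would give `512 * h ≤ gap * β ≤ 8 * h`.
    by_contra! h3
    have h4 : (I.gap (I.beta₁ v) + 1) * (I.bundleGroups₁ v \ J).card ≤ 4 * I.h := by
      exact_mod_cast hcard
    have h5 := Nat.mul_le_mul_left (I.gap (I.beta₁ v)) h3.le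
    have h6 := I.h_pos
    nlinarith
  · have := hbal U hU U' hU'
    rwa [← mul_sub, abs_mul] at this

theorem four_mul_abs_le_colT (L : Layout I ρ ρ') {S : I.Solution} (hS : S.Perfect) (hM : 2 ≤ I.M)
    {e e' : V₁ × V₂} (he : e ∈ S.allEdges) (he' : e' ∈ S.allEdges) (h2 : e.2 = e'.2) :
    4 * |(S.bundleRank ρ ρ' e.1 (groupOf I.groups₂ e.2) : ℤ) -
        S.bundleRank ρ ρ' e'.1 (groupOf I.groups₂ e'.2)| ≤
      |((L.colT e.2 (groupOf I.groups₁ e.1) : ℕ) : ℤ) -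
        (L.colT e'.2 (groupOf I.groups₁ e'.1) : ℕ)| := by
  have key : ∀ {e e' : V₁ × V₂}, e ∈ S.allEdges → e' ∈ S.allEdges → e.2 = e'.2 →
      S.edgeKey ρ ρ' e < S.edgeKey ρ ρ' e' →
      4 * |(S.bundleRank ρ ρ' e.1 (groupOf I.groups₂ e.2) : ℤ) -
        S.bundleRank ρ ρ' e'.1 (groupOf I.groups₂ e'.2)| ≤
      |((L.colT e.2 (groupOf I.groups₁ e.1) : ℕ) : ℤ) -
        (L.colT e'.2 (groupOf I.groups₁ e'.1) : ℕ)| := by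
    intro e e' he he' h2 hlt
    have hb := groupOf_mem_bundleGroups₂ (mem_edges_of_mem_allEdges he)
    have hb' := groupOf_mem_bundleGroups₂ (mem_edges_of_mem_allEdges he')
    rw [← h2] at hb'
    have h3 := hS.bundleRank_le_add_keyRank he he' h2 hlt
    have h4 := sub_eq_mul_rank ρ ρ.injective (fun U => ((L.colT e.2 U : ℕ) : ℤ))
      (I.gap (I.beta₂ e.2) + 1) (I.bundleGroups₂ e.2)
      (fun U hU U' hU' hlt hcons => by
        have := L.colT_gap e.2 U U' ⟨hU, hU', hlt, hcons⟩
        push_cast [this]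
        ring) _ hb _ hb'
    have h5 : S.bundleRank ρ ρ' e.1 (groupOf I.groups₂ e.2) <
        S.bundleRank ρ ρ' e'.1 (groupOf I.groups₂ e'.2) := keyRank_lt (s := S.allEdges) he hlt
    have h6 := le_gap hM (beta₂_pos ⟨_, hb⟩)
    rw [abs_sub_comm, abs_of_nonneg (by omega), abs_sub_comm, ← h2]
    refine le_trans ?_ (le_abs_self _)
    rw [h4]
    rw [← h2] at h3 h5
    have h7 : (4 : ℤ) ≤ (I.gap (I.beta₂ e.2) : ℤ) + 1 := by omega
    zify at h3 h5
    refine le_trans ?_ (mul_le_mul_of_nonneg_right h7 (by linarith))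
    linarith
  rcases lt_trichotomy (S.edgeKey ρ ρ' e) (S.edgeKey ρ ρ' e') with h | h | h
  · exact key he he' h2 h
  · rw [hS.edgeKey_injOn he he' h]
    simp
  · rw [abs_sub_comm, abs_sub_comm (((L.colT e.2 _ : ℕ) : ℤ))]
    exact key he' he h2.symm h

/-- At least half of the edges of a perfect solution can be routed, for any ordering of the groups
and any choices in the construction. -/
theorem canRouteSpacedOut (L : Layout I ρ ρ') {S : I.Solution} (hS : S.Perfect) (hI : I.Valid)
    (hM : 2 ≤ I.M) : CanRouteSpacedOut L.demandPairs ((I.betaStar : ℝ) / 2) := by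
  choose J hJ hJcard hJbal using fun v => L.exists_balanced_bundles S hM v
  let F := S.allEdges.filter fun e => groupOf I.groups₂ e.2 ∈ J e.1
  have hF : ∀ e ∈ F, e ∈ S.allEdges := fun e he => (Finset.mem_filter.1 he).1
  have hFJ : ∀ e ∈ F, groupOf I.groups₂ e.2 ∈ J e.1 := fun e he => (Finset.mem_filter.1 he).2
  have hFcard : I.betaStar ≤ 2 * F.card := by
    -- Each bundle holds at most one solution edge, so the discarded edges are no more numerous than
    -- the lost bundles, which are at most half of `β*`.
    have h1 : (S.allEdges.filter fun e => ¬ groupOf I.groups₂ e.2 ∈ J e.1).card ≤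
        (Finset.univ.sigma fun v => I.bundleGroups₁ v \ J v).card := by
      refine Finset.card_le_card_of_injOn (fun e => ⟨e.1, groupOf I.groups₂ e.2⟩) ?_ ?_
      · intro e he
        obtain ⟨he, he'⟩ := Finset.mem_filter.1 he
        refine Finset.mem_coe.2 (Finset.mem_sigma.2 ⟨Finset.mem_univ _, Finset.mem_sdiff.2
          ⟨groupOf_mem_bundleGroups₁ (mem_edges_of_mem_allEdges he), he'⟩⟩)
      · intro e he e' he' h
        have he := (Finset.mem_filter.1 he).1
        have he' := (Finset.mem_filter.1 he').1
        simp only [Sigma.mk.injEq, heq_eq_eq] at h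
        apply hS.edgeKey_injOn (ρ := ρ) (ρ' := ρ') he he'
        unfold Solution.edgeKey
        rw [h.1, h.2]
    have h2 : 2 * (Finset.univ.sigma fun v => I.bundleGroups₁ v \ J v).card ≤ I.betaStar := by
      rw [Finset.card_sigma, Finset.mul_sum]
      exact Finset.sum_le_sum fun v _ => hJcard v
    have h3 := Finset.card_filter_add_card_filter_not (s := S.allEdges)
      (fun e => groupOf I.groups₂ e.2 ∈ J e.1)
    rw [hS.card_allEdges hI] at h3
    change F.card + _ = _ at h3
    omega
  let lam : V₁ × V₂ → ℕ := fun e => S.bundleRank ρ ρ' e.1 (groupOf I.groups₂ e.2)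
  have hlam : ∀ e, lam e ≤ I.M := fun e => bundleRank_le _ _
  have hdiff : ∀ e e', 4 * |(lam e : ℤ) - lam e'| ≤ (10 * I.M : ℕ) := by
    intro e e'
    have := hlam e
    have := hlam e'
    have : |(lam e : ℤ) - lam e'| ≤ I.M := abs_le.2 (by omega)
    push_cast
    linarith
  have hSb : ∀ e ∈ S.allEdges, _ := fun e he =>
    L.colS_block e.1 _ (groupOf_mem_bundleGroups₁ (mem_edges_of_mem_allEdges he))
  have hTb : ∀ e ∈ S.allEdges, _ := fun e he =>
    L.colT_block e.2 _ (groupOf_mem_bundleGroups₂ (mem_edges_of_mem_allEdges he))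
  have hs : ∀ e ∈ F, ∀ e' ∈ F, 4 * |(lam e : ℤ) - lam e'| ≤
      |((L.colS e.1 (groupOf I.groups₂ e.2) : ℕ) : ℤ) -
        (L.colS e'.1 (groupOf I.groups₂ e'.2) : ℕ)| := by
    intro e he e' he'
    by_cases h1 : e.1 = e'.1
    · have := hJbal e.1 _ (hFJ e he) _ (h1 ▸ hFJ e' he')
      simp only [lam]
      rw [← h1]
      exact this
    · exact (hdiff e e').trans (L.start_sep.le_abs_sub (L.σ.injective.ne h1) (hSb e (hF e he))
        (hSb e' (hF e' he')))
  have ht : ∀ e ∈ F, ∀ e' ∈ F, 4 * |(lam e : ℤ) - lam e'| ≤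
      |((L.colT e.2 (groupOf I.groups₁ e.1) : ℕ) : ℤ) -
        (L.colT e'.2 (groupOf I.groups₁ e'.1) : ℕ)| := by
    intro e he e' he'
    by_cases h2 : e.2 = e'.2
    · exact L.four_mul_abs_le_colT hS hM (hF e he) (hF e' he') h2
    · exact (hdiff e e').trans (L.start'_sep.le_abs_sub (L.σ'.injective.ne h2) (hTb e (hF e he))
        (hTb e' (hF e' he')))
  let pair : V₁ × V₂ → GridVertex I.side × GridVertex I.side := fun e =>
    ((L.rowS, L.colS e.1 (groupOf I.groups₂ e.2)), (L.rowT, L.colT e.2 (groupOf I.groups₁ e.1)))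
  have hpair : Set.InjOn pair (F : Set (V₁ × V₂)) := by
    intro e he e' he' h
    have h1 : L.colS e.1 (groupOf I.groups₂ e.2) = L.colS e'.1 (groupOf I.groups₂ e'.2) :=
      congrArg (fun p => p.1.2) h
    have h2 := hs e he e' he'
    -- Equal source columns force equal ranks, hence equal edges; so distinct edges of `F` yield
    -- distinct demand pairs.
    rw [h1, sub_self, abs_zero] at h2
    have h3 := abs_nonneg ((lam e : ℤ) - lam e')
    have h4 : (lam e : ℤ) - lam e' = 0 := abs_eq_zero.1 (by omega)
    have h5 : lam e = lam e' := by omega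
    exact hS.bundleRank_injOn (hF e he) (hF e' he') h5
  have hD : ∀ d : (F.image pair : Finset _), ∃ e ∈ F, pair e = d.1 :=
    fun d => Finset.mem_image.1 d.2
  choose e heF hpe using hD
  have hside := le_side hM
  have hM0 : (0 : ℝ) ≤ I.M := by positivity
  have hsideR : 4096 * (I.M : ℝ) ≤ I.side := by exact_mod_cast hside
  have hM2 : (2 : ℝ) ≤ I.M := by exact_mod_cast hM
  have hfar : ∀ x : ℕ, RowFarFromBoundary I.side x → 4 * I.M + 1 ≤ x ∧ x + 4 * I.M + 2 ≤ I.side := by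
    intro x hx
    have h1 : ((4 * I.M + 1 : ℕ) : ℝ) ≤ x := by push_cast; linarith [hx.1]
    have h2 : ((x + 4 * I.M + 2 : ℕ) : ℝ) ≤ I.side := by push_cast; linarith [hx.2]
    exact ⟨by exact_mod_cast h1, by exact_mod_cast h2⟩
  have hrows : (L.rowS : ℕ) + 16 * I.M + 4 ≤ L.rowT ∨ (L.rowT : ℕ) + 16 * I.M + 4 ≤ L.rowS := by
    rcases le_abs.1 L.rows_far with h | h
    · right
      have : (((L.rowT : ℕ) + 16 * I.M + 4 : ℕ) : ℝ) ≤ (L.rowS : ℕ) := by push_cast; linarith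
      exact_mod_cast this
    · left
      have : (((L.rowS : ℕ) + 16 * I.M + 4 : ℕ) : ℝ) ≤ (L.rowT : ℕ) := by push_cast; linarith
      exact_mod_cast this
  obtain ⟨P, hP, hPb⟩ := exists_spacedOut_paths (ι := (F.image pair : Finset _))
    (fun d => d.1.1) (fun d => d.1.2) L.rowS L.rowT I.M
    (fun d => by rw [← hpe d]) (fun d => by rw [← hpe d]) (fun d => lam (e d))
    (fun d d' h => by
      have := hS.bundleRank_injOn (hF _ (heF d)) (hF _ (heF d')) h
      exact Subtype.ext (by rw [← hpe d, ← hpe d', this]))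
    (fun d => hlam _)
    (fun d d' => by
      rw [← hpe d, ← hpe d']
      exact hs _ (heF d) _ (heF d'))
    (fun d d' => by
      rw [← hpe d, ← hpe d']
      exact ht _ (heF d) _ (heF d'))
    (fun d => by
      rw [← hpe d]
      have h1 := hSb _ (hF _ (heF d))
      have h2 := L.start_sep.2.1 (L.σ (e d).1)
      have h3 := L.start_sep.2.2 (L.σ (e d).1)
      simp only [pair]
      omega)
    (fun d => by
      rw [← hpe d]
      have h1 := hTb _ (hF _ (heF d))
      have h2 := L.start'_sep.2.1 (L.σ' (e d).2)
      have h3 := L.start'_sep.2.2 (L.σ' (e d).2)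
      simp only [pair]
      omega)
    (hfar _ L.rowS_far).1 (hfar _ L.rowS_far).2 (hfar _ L.rowT_far).1 (hfar _ L.rowT_far).2 hrows
  refine ⟨F.image pair, Finset.image_subset_image fun e he => mem_edges_of_mem_allEdges (hF e he),
    ?_, P, hP, fun d x hx hb => (hPb d x hx hb).elim⟩
  rw [Finset.card_image_of_injOn hpair, div_le_iff₀ two_pos, mul_comm]
  exact_mod_cast hFcard

end Layout

/-! ### Existence of a layout. -/

/-- Every ordering of the groups is respected by some ordering of the vertices. -/
theorem exists_respectsGroups {V : Type*} [Fintype V] [DecidableEq V]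
    {P : Finpartition (Finset.univ : Finset V)} (ρ : GroupOrder P) :
    ∃ σ : V ≃ Fin (Fintype.card V), RespectsGroups ρ σ := by
  let e := Fintype.equivFin V
  let f : Fin (Fintype.card V) → Fin P.parts.card := fun i => ρ (groupOf P (e.symm i))
  refine ⟨e.trans (Tuple.sort f).symm, fun u v huv => ?_⟩
  by_contra! h
  have := Tuple.monotone_sort f h
  simp only [Function.comp, Equiv.trans_apply, Equiv.apply_symm_apply, f,
    Equiv.symm_apply_apply] at this
  exact this.not_gt huv

/-- Columns for the terminals of one block. -/
theorem exists_terminal_columns {α : Type*} {n : ℕ} (pos : α → Fin n)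
    (hpos : Function.Injective pos) (A : Finset α) (ℓ start len G : ℕ) (hℓ : start + len ≤ ℓ)
    (hℓ0 : 0 < ℓ) (hfit : 0 < A.card → (A.card - 1) * G + 1 ≤ len) :
    ∃ col : α → Fin ℓ, (∀ u ∈ A, start ≤ (col u : ℕ) ∧ (col u : ℕ) < start + len) ∧
      ∀ u ∈ A, ∀ v ∈ A, pos u < pos v → (∀ w ∈ A, ¬ (pos u < pos w ∧ pos w < pos v)) →
        (col v : ℕ) = col u + G := by
  classical
  have hb : ∀ u ∈ A, keyRank A pos (pos u) * G + 1 ≤ len := by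
    intro u hu
    have h1 : keyRank A pos (pos u) < A.card :=
      Finset.card_lt_card (Finset.filter_ssubset.2 ⟨u, hu, lt_irrefl _⟩)
    have h2 := Nat.mul_le_mul_right G (show keyRank A pos (pos u) ≤ A.card - 1 by omega)
    have h3 := hfit (by omega)
    omega
  -- The minimum with `ℓ - 1` only keeps the irrelevant values outside `A` within range.
  have hval : ∀ u ∈ A, min (start + keyRank A pos (pos u) * G) (ℓ - 1) =
      start + keyRank A pos (pos u) * G := by
    intro u hu
    have := hb u hu
    exact min_eq_left (by omega)
  refine ⟨fun u => ⟨min (start + keyRank A pos (pos u) * G) (ℓ - 1), by omega⟩,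
    fun u hu => ?_, fun u hu v hv huv hcons => ?_⟩
  · have := hb u hu
    dsimp only
    rw [hval u hu]
    omega
  · dsimp only
    rw [hval u hu, hval v hv]
    have h1 := keyRank_add_card (s := A) (key := pos) huv.le
    have h2 : (A.filter fun w => pos u ≤ pos w ∧ pos w < pos v) = {u} := by
      ext w
      simp only [Finset.mem_filter, Finset.mem_singleton]
      constructor
      · rintro ⟨hw, h3, h4⟩
        by_contra hne
        exact hcons w hw ⟨lt_of_le_of_ne h3 fun h => hne (hpos h).symm, h4⟩
      · rintro rfl
        exact ⟨hu, le_rfl, huv⟩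
    rw [h2, Finset.card_singleton] at h1
    rw [← h1]
    ring

namespace GPwB

variable {V₁ V₂ : Type*} [Fintype V₁] [DecidableEq V₁] [Fintype V₂] [DecidableEq V₂]
  {I : GPwB V₁ V₂}

/-- Any edge of a bundle determines its group, so different groups give different bundles. -/
theorem card_bundleGroups₁ (v : V₁) : (I.bundleGroups₁ v).card = I.beta₁ v := by
  refine (Finset.card_image_of_injOn fun U hU U' _ h => ?_).symm
  obtain ⟨e, he⟩ := (Finset.mem_filter.1 hU).2
  have he' : e ∈ I.bundle₁ v U'.1 := (show I.bundle₁ v U.1 = I.bundle₁ v U'.1 from h) ▸ he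
  exact (groupOf_eq_iff.2 (Finset.mem_filter.1 he).2.2).symm.trans
    (groupOf_eq_iff.2 (Finset.mem_filter.1 he').2.2)

theorem card_bundleGroups₂ (v : V₂) : (I.bundleGroups₂ v).card = I.beta₂ v := by
  refine (Finset.card_image_of_injOn fun U hU U' _ h => ?_).symm
  obtain ⟨e, he⟩ := (Finset.mem_filter.1 hU).2
  have he' : e ∈ I.bundle₂ v U'.1 := (show I.bundle₂ v U.1 = I.bundle₂ v U'.1 from h) ▸ he
  exact (groupOf_eq_iff.2 (Finset.mem_filter.1 he).2.2).symm.trans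
    (groupOf_eq_iff.2 (Finset.mem_filter.1 he').2.2)

theorem Solution.Perfect.h_le_M {S : I.Solution} (hS : S.Perfect) : I.h ≤ I.M := by
  rw [← hS.2.2 ⟨0, I.r_pos⟩]
  exact Finset.card_le_card (S.E_sub _)

/-- The terminals of a vertex with `β` bundles fit into a block. -/
theorem terminals_fit (hM : 2 ≤ I.M) (hh : I.h ≤ I.M) {β : ℕ} (hβ : 0 < β) (hβh : β ≤ I.h) :
    (β - 1) * (I.gap β + 1) + 1 ≤ I.blockLen := by
  have hlog := one_le_logb hM
  obtain ⟨b, rfl⟩ : ∃ b, β = b + 1 := ⟨β - 1, by omega⟩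
  unfold gap blockLen
  set x : ℝ := (I.h : ℝ) * Real.logb 2 I.M with hx
  have hhR : ((b + 1 : ℕ) : ℝ) ≤ I.h := by exact_mod_cast hβh
  have hb0 : (0 : ℝ) < ((b + 1 : ℕ) : ℝ) := by positivity
  have hx0 : (I.h : ℝ) ≤ x := le_mul_of_one_le_right (by positivity) hlog
  set c := ⌈x / ((b + 1 : ℕ) : ℝ)⌉₊ with hc
  set N := ⌈x⌉₊ with hN
  have hxN : x ≤ N := Nat.le_ceil x
  have hcpos : 0 < c := Nat.ceil_pos.2 (by
    have : (0 : ℝ) < I.h := by exact_mod_cast I.h_pos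
    exact div_pos (by linarith) hb0)
  have h1 : (b + 1) * c < N + (b + 1) := by
    have h2 : (c : ℝ) < x / ((b + 1 : ℕ) : ℝ) + 1 := Nat.ceil_lt_add_one (by
      exact div_nonneg ((Nat.cast_nonneg _).trans hx0) hb0.le)
    have h3 : ((b + 1 : ℕ) : ℝ) * c < N + ((b + 1 : ℕ) : ℝ) := by
      calc ((b + 1 : ℕ) : ℝ) * c < ((b + 1 : ℕ) : ℝ) * (x / ((b + 1 : ℕ) : ℝ) + 1) := by gcongr
        _ = x + ((b + 1 : ℕ) : ℝ) := by field_simp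
        _ ≤ _ := by gcongr
    exact_mod_cast h3
  have h4 : b + 1 ≤ N := by
    have : ((b + 1 : ℕ) : ℝ) ≤ N := hhR.trans (hx0.trans hxN)
    exact_mod_cast this
  -- Rounding `c` up can cost nearly `512` vertices per terminal. For `M ≥ 4` the logarithm is at
  -- least `2` and the block has room for this; for `M < 4` there are at most three terminals, and
  -- the missing gap after the last one compensates.
  have h5 : b + 1 ≤ 3 ∨ 2 * (b + 1) ≤ N := by
    rcases Nat.lt_or_ge I.M 4 with h | h
    · left; omega
    · right
      have h6 : (2 : ℝ) ≤ Real.logb 2 I.M := by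
        rw [Real.le_logb_iff_rpow_le (by norm_num) (by positivity)]
        have : (4 : ℝ) ≤ I.M := by exact_mod_cast h
        norm_num
        exact_mod_cast this
      have h7 : (I.h : ℝ) * 2 ≤ x := by rw [hx]; gcongr
      have h8 : 2 * ((b + 1 : ℕ) : ℝ) ≤ N := by linarith
      exact_mod_cast h8
  have h6 : (b + 1 - 1) * (512 * c + 1) + 1 + 512 * c = 512 * ((b + 1) * c) + (b + 1) := by
    rw [Nat.add_sub_cancel]; ring
  omega

/-- The blocks of at most `M` vertices fit into the grid. -/
theorem blocks_fit (hM : 2 ≤ I.M) (hh : I.h ≤ I.M) :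
    10 * I.M + 2 + I.M * (I.blockLen + 10 * I.M) ≤ I.side := by
  have hlog := one_le_logb hM
  unfold blockLen side
  set N := ⌈(I.h : ℝ) * Real.logb 2 I.M⌉₊ with hN
  set Q := ⌈(I.M : ℝ) ^ 2 * Real.logb 2 I.M⌉₊ with hQ
  have hQ' : (I.M : ℝ) ^ 2 * Real.logb 2 I.M ≤ Q := Nat.le_ceil _
  have h1 : I.M ^ 2 ≤ Q := by
    have : ((I.M ^ 2 : ℕ) : ℝ) ≤ Q := by
      push_cast
      exact (le_mul_of_one_le_right (by positivity) hlog).trans hQ'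
    exact_mod_cast this
  have h2 : I.M * N ≤ Q + I.M := by
    have hhR : (I.h : ℝ) ≤ I.M := by exact_mod_cast hh
    have h3 : (N : ℝ) ≤ I.M * Real.logb 2 I.M + 1 := by
      refine (Nat.ceil_lt_add_one (by positivity)).le.trans ?_
      gcongr
    have h4 : (I.M : ℝ) * N ≤ Q + I.M := by
      calc (I.M : ℝ) * N ≤ I.M * (I.M * Real.logb 2 I.M + 1) := by gcongr
        _ = (I.M : ℝ) ^ 2 * Real.logb 2 I.M + I.M := by ring
        _ ≤ _ := by gcongr
    exact_mod_cast h4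
  nlinarith

/-- Evenly placed blocks. -/
theorem blocksSeparated_of_le (hM : 2 ≤ I.M) (hh : I.h ≤ I.M) {n : ℕ} (hn : n ≤ I.M) :
    BlocksSeparated I.side I.blockLen (10 * I.M)
      (fun i : Fin n => 1 + 10 * I.M + (i : ℕ) * (I.blockLen + 10 * I.M)) := by
  have hfit := blocks_fit hM hh
  refine ⟨fun i j hij => ?_, fun i => by dsimp only; omega, fun i => ?_⟩
  · have := Nat.mul_le_mul_right (I.blockLen + 10 * I.M) (show (i : ℕ) + 1 ≤ j from hij)
    rw [add_mul] at this
    dsimp only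
    omega
  · have := Nat.mul_le_mul_right (I.blockLen + 10 * I.M) (show (i : ℕ) + 1 ≤ I.M by omega)
    rw [add_mul] at this
    dsimp only
    omega

/-- The choices required by the construction can be made. -/
theorem nonempty_layout (hM : 2 ≤ I.M) (hI : I.Valid) (hh : I.h ≤ I.M)
    (h₁ : Fintype.card V₁ ≤ I.M) (h₂ : Fintype.card V₂ ≤ I.M)
    (ρ : GroupOrder I.groups₁) (ρ' : GroupOrder I.groups₂) : Nonempty (Layout I ρ ρ') := by
  obtain ⟨σ, hσ⟩ := exists_respectsGroups ρ
  obtain ⟨σ', hσ'⟩ := exists_respectsGroups ρ'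
  have hside := le_side hM
  have hsep := blocksSeparated_of_le hM hh h₁
  have hsep' := blocksSeparated_of_le hM hh h₂
  have hcol := fun v => exists_terminal_columns ρ' ρ'.injective (I.bundleGroups₁ v) I.side
    (1 + 10 * I.M + (σ v : ℕ) * (I.blockLen + 10 * I.M)) I.blockLen (I.gap (I.beta₁ v) + 1)
    (by have := hsep.2.2 (σ v); dsimp only at this; omega) (by omega)
    (fun h => by
      rw [card_bundleGroups₁] at h ⊢
      exact terminals_fit hM hh h (hI.2.1 v))
  have hcol' := fun v => exists_terminal_columns ρ ρ.injective (I.bundleGroups₂ v) I.side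
    (1 + 10 * I.M + (σ' v : ℕ) * (I.blockLen + 10 * I.M)) I.blockLen (I.gap (I.beta₂ v) + 1)
    (by have := hsep'.2.2 (σ' v); dsimp only at this; omega) (by omega)
    (fun h => by
      rw [card_bundleGroups₂] at h ⊢
      exact terminals_fit hM hh h (hI.2.2 v))
  choose colS hS hSg using hcol
  choose colT hT hTg using hcol'
  obtain ⟨Q, hQ⟩ : ∃ Q, I.side = 2048 * Q := ⟨_, rfl⟩
  have hQ1 : (1 : ℝ) ≤ Q := by exact_mod_cast (by omega : 1 ≤ Q)
  have hQR : (I.side : ℝ) = 2048 * Q := by exact_mod_cast hQ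
  exact ⟨{
    σ := σ
    σ' := σ'
    σ_respects := hσ
    σ'_respects := hσ'
    -- The rows at `ℓ / 4` and `ℓ / 2`.
    rowS := ⟨512 * Q, by omega⟩
    rowT := ⟨1024 * Q, by omega⟩
    rowS_far := by
      constructor <;> rw [hQR] <;> push_cast <;> linarith
    rowT_far := by
      constructor <;> rw [hQR] <;> push_cast <;> linarith
    rows_far := by
      rw [hQR, abs_sub_comm]
      refine le_trans ?_ (le_abs_self _)
      push_cast
      linarith
    start := _
    start' := _
    start_sep := hsep
    start'_sep := hsep'
    colS := colS
    colT := colT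
    colS_block := hS
    colT_block := hT
    colS_gap := fun v U U' h => hSg v U h.1 U' h.2.1 h.2.2.1 h.2.2.2
    colT_gap := fun v U U' h => hTg v U h.1 U' h.2.1 h.2.2.1 h.2.2.2 }⟩

end GPwB

/-! ### The theorem. -/

theorem mainTheorem7 :
    ∃ c : ℝ, 0 < c ∧
      ∀ (V₁ V₂ : Type*) [Fintype V₁] [DecidableEq V₁] [Fintype V₂] [DecidableEq V₂]
        (I : GPwB V₁ V₂), 2 ≤ I.M → I.Valid → (∃ S : I.Solution, S.Perfect) →
        (Fintype.card V₁ ≤ I.M → Fintype.card V₂ ≤ I.M →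
          ∀ (ρ : GroupOrder I.groups₁) (ρ' : GroupOrder I.groups₂), Nonempty (Layout I ρ ρ')) ∧
        ∀ ρ : GroupOrder I.groups₁,
          1 / 2 ≤ (PMF.uniformOfFintype (GroupOrder I.groups₂)).toOuterMeasure
            {ρ' | ∀ L : Layout I ρ ρ',
              CanRouteSpacedOut L.demandPairs
                (c * (I.betaStar : ℝ) / Real.logb 2 (I.M : ℝ) ^ 3)} := by
  refine ⟨1 / 2, by norm_num, ?_⟩
  intro V₁ V₂ _ _ _ _ I hM hI ⟨S, hS⟩
  refine ⟨fun h₁ h₂ ρ ρ' => GPwB.nonempty_layout hM hI hS.h_le_M h₁ h₂ ρ ρ', fun ρ => ?_⟩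
  have hall : ∀ ρ' : GroupOrder I.groups₂, ∀ L : Layout I ρ ρ', CanRouteSpacedOut L.demandPairs
      (1 / 2 * (I.betaStar : ℝ) / Real.logb 2 (I.M : ℝ) ^ 3) := by
    intro ρ' L
    obtain ⟨D, hD, hcard, hP⟩ := L.canRouteSpacedOut hS hI hM
    refine ⟨D, hD, le_trans ?_ hcard, hP⟩
    have hlog : 1 ≤ Real.logb 2 (I.M : ℝ) ^ 3 := one_le_pow₀ (GPwB.one_le_logb hM)
    refine (div_le_self (by positivity) hlog).trans (le_of_eq (by ring))
  -- The event contains every ordering, so its probability is `1`.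
  refine le_of_le_of_eq (by simp) ((PMF.toOuterMeasure_apply_eq_one_iff _ _).2 ?_).symm
  exact fun ρ' _ => hall ρ'
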